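/- Let $n\ge 1$, write points of $\mathbb R^{n+1}$ as $X=(x,z)$ with $x\in\mathbb R^n$, $z\in\mathbb R$, and let $\Omega\subset\mathbb R^{n+1}$ be open and symmetric under $z\mapsto -z$. Put $\tilde\Omega=\Omega\cap(\mathbb R^n\times\{0\})$ and, for a function $f$ on $\Omega$, $\mathcal N(f)=\{(x,0)\in\Omega: f(x,0)=0\}$, and let $\mathcal N^o(f)$ be the interior of $\mathcal N(f)$ relative to $\mathbb R^n\times\{0\}$. The class $\mathcal G(\Omega)$ of segregated critical profiles consists of the vector functions $\mathbf u=(u_1,\dots,u_k)$, even in $z$, with nonnegative components $u_i\in H^1(\Omega)$ that are Hölder continuous of exponent $1/2$ on compact subsets of $\Omega$, such that * (G1) $-\Delta u_i=0$ in $\Omega\setminus\mathcal N(u_i)$ for every $i$; * (G2) $\tilde\Omega=\bigcup_{i=1}^k\mathcal N(u_i)$, and $\mathcal N^o(u_i)\cap\mathcal N^o\big(\sum_{j\ne i}u_j\big)=\emptyset$ for every $i$; * (G3) for every vector field $Y\in C_c^\infty(\Omega;\mathbb R^{n+1})$ whose $z$-component is odd in $z$, $$\int_\Omega\Big\{\sum_i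 dY\,\nabla u_i\cdot\nabla u_i-\tfrac12\,\mathrm{div}\,Y\,|\nabla\mathbf u|^2\Big\}\,dX=0,\qquad |\nabla\mathbf u|^2=\sum_i|\nabla u_i|^2 .$$ Theorem. Let $x_0\in\mathbb R^n$, $X_0=(x_0,0)$, $r_0>0$, and let $\mathbf u\in\mathcal G(B_{r_0}(X_0))$ with $\mathbf u\not\equiv 0$. For $0<r<r_0$ set $$E(r)=\frac1{r^{n-1}}\int_{B_r(X_0)}\sum_i|\nabla u_i|^2\,dx\,dz,\qquad H(r)=\frac1{r^n}\int_{\partial B_r(X_0)}\sum_i u_i^2\,d\sigma,\qquad N(r)=\frac{E(r)}{H(r)} .$$ Then $N$ is well defined on $(0,r_0)$ (the integrals are finite and $H(r)>0$ for every $r\in(0,r_0)$), $N$ is absolutely continuous and nondecreasing on $(0,r_0)$, and for every $r\in(0,r_0)$ $$\frac{d}{dr}\log H(r)=\frac{2N(r)}{r}.$$ Moreover, if $N(r)=\gamma$ for all $r$ in some nonempty open interval contained in $(0,r_0)$, then $N(r)=\gamma$ for all $r\in(0,r_0)$, and $\mathbf u$ is homogeneous of degree $\gamma$ about $X_0$: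 $\mathbf u(X_0+tY)=t^\gamma\,\mathbf u(X_0+Y)$ for all $t>0$ and all $Y\in\mathbb R^{n+1}$ with $|Y|<r_0$ and $t|Y|<r_0$. -/

import Mathlib

open MeasureTheory Set Metric
open scoped ContDiff

noncomputable section

namespace Segregation

/-- The space `ℝⁿ⁺¹ = ℝⁿ × ℝ` with its Euclidean norm; the last coordinate is `z`. -/
abbrev Pt (n : ℕ) : Type := EuclideanSpace ℝ (Fin (n + 1))

/-- The point `(x, 0)` of the characteristic hyperplane `{z = 0}`. -/
def onPlane {n : ℕ} (x : EuclideanSpace ℝ (Fin n)) : Pt n :=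
  WithLp.toLp 2 (Fin.snoc (α := fun _ => ℝ) (fun j => x j) 0)

/-- The reflection `(x, z) ↦ (x, -z)`. -/
def reflectZ {n : ℕ} (X : Pt n) : Pt n :=
  WithLp.toLp 2 (Function.update (fun j => X j) (Fin.last n) (-X (Fin.last n)))

/-- `φ ∈ C_c^∞(Ω; F)`. -/
structure IsTest {n : ℕ} {F : Type*} [NormedAddCommGroup F] [NormedSpace ℝ F]
    (Ω : Set (Pt n)) (φ : Pt n → F) : Prop where
  smooth : ContDiff ℝ ∞ φ
  compact : HasCompactSupport φ
  support : tsupport φ ⊆ Ω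

/-- `G` is a weak gradient of `f` on `Ω`: `∫_Ω f ∇φ = - ∫_Ω φ G` for all test functions `φ`. -/
structure IsWeakGradient {n : ℕ} (Ω : Set (Pt n)) (f : Pt n → ℝ) (G : Pt n → Pt n) : Prop where
  locInt : LocallyIntegrableOn f Ω
  locInt_grad : LocallyIntegrableOn G Ω
  parts : ∀ φ : Pt n → ℝ, IsTest Ω φ →
    ∫ X in Ω, f X • gradient φ X = - ∫ X in Ω, φ X • G X

open Classical in
/-- The weak gradient `∇f` on `Ω` (unique up to a null set when it exists). -/
def weakGradient {n : ℕ} (Ω : Set (Pt n)) (f : Pt n → ℝ) : Pt n → Pt n :=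
  if h : ∃ G, IsWeakGradient Ω f G then h.choose else 0

/-- The Sobolev space `H¹(Ω)`. -/
def MemH1 {n : ℕ} (Ω : Set (Pt n)) (f : Pt n → ℝ) : Prop :=
  MemLp f 2 (volume.restrict Ω) ∧
    ∃ G, IsWeakGradient Ω f G ∧ MemLp G 2 (volume.restrict Ω)

/-- The trace `{x ∈ ℝⁿ : (x, 0) ∈ Ω}` of `Ω` on the characteristic hyperplane. -/
def planeTrace {n : ℕ} (Ω : Set (Pt n)) : Set (EuclideanSpace ℝ (Fin n)) :=
  {x | onPlane x ∈ Ω}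

/-- The nodal set `{x ∈ ℝⁿ : (x, 0) ∈ Ω, f (x, 0) = 0}`, as a subset of `ℝⁿ`. -/
def nodalSet {n : ℕ} (Ω : Set (Pt n)) (f : Pt n → ℝ) : Set (EuclideanSpace ℝ (Fin n)) :=
  {x | onPlane x ∈ Ω ∧ f (onPlane x) = 0}

/-- The divergence of a vector field. -/
def divergence {n : ℕ} (Y : Pt n → Pt n) (X : Pt n) : ℝ :=
  ∑ j, (fderiv ℝ Y X (EuclideanSpace.single j 1)) j

/-- `|∇u|² = ∑ᵢ |∇uᵢ|²`. -/
def gradSq {n k : ℕ} (Ω : Set (Pt n)) (u : Fin k → Pt n → ℝ) (X : Pt n) : ℝ :=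
  ∑ i, ‖weakGradient Ω (u i) X‖ ^ 2

/-- The class `𝒢(Ω)` of segregated critical profiles, for an open, `z`-symmetric `Ω`.
Only the values of `u` on `Ω` matter. -/
structure ClassG {n k : ℕ} (Ω : Set (Pt n)) (u : Fin k → Pt n → ℝ) : Prop where
  even : ∀ i, ∀ X ∈ Ω, u i (reflectZ X) = u i X
  nonneg : ∀ i, ∀ X ∈ Ω, 0 ≤ u i X
  memH1 : ∀ i, MemH1 Ω (u i)
  /-- `C^{0,1/2}` regularity, on compact subsets of `Ω`. -/
  holder : ∀ i, ∀ K ⊆ Ω, IsCompact K → ∃ C : NNReal, HolderOnWith C (1 / 2) (u i) K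
  /-- (G1): `uᵢ` is harmonic off its nodal set. -/
  harmonic : ∀ i,
    InnerProductSpace.HarmonicOnNhd (u i) (Ω \ (onPlane '' nodalSet Ω (u i)))
  /-- (G2), covering condition. -/
  cover : planeTrace Ω = ⋃ i, nodalSet Ω (u i)
  /-- (G2), disjointness; `interior` is the interior in `ℝⁿ`. -/
  disjoint : ∀ i, interior (nodalSet Ω (u i)) ∩
    interior (nodalSet Ω (fun X => ∑ j ∈ Finset.univ.erase i, u j X)) = ∅
  /-- (G3): the odd-in-`z` domain variation formula. -/
  variation : ∀ Y : Pt n → Pt n, IsTest Ω Y →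
    (∀ X, Y (reflectZ X) (Fin.last n) = - Y X (Fin.last n)) →
    ∫ X in Ω, (∑ i, inner ℝ (fderiv ℝ Y X (weakGradient Ω (u i) X)) (weakGradient Ω (u i) X)
      - 1 / 2 * divergence Y X * gradSq Ω u X) = 0

/-- The surface integral `∫_{∂B_r(X₀)} f dσ`, where `volume.toSphere` is the surface measure
of the unit sphere. -/
def sphereIntegral {n : ℕ} (X₀ : Pt n) (r : ℝ) (f : Pt n → ℝ) : ℝ :=
  r ^ n * ∫ ξ : sphere (0 : Pt n) 1, f (X₀ + r • (ξ : Pt n)) ∂(volume.toSphere)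

/-- `E(r) = r^{-(n-1)} ∫_{B_r(X₀)} ∑ᵢ |∇uᵢ|²`, for `u` defined on `Ω ⊇ B_r(X₀)`. -/
def energyE {n k : ℕ} (Ω : Set (Pt n)) (X₀ : Pt n) (u : Fin k → Pt n → ℝ) (r : ℝ) : ℝ :=
  (1 / r ^ ((n : ℤ) - 1)) * ∫ X in ball X₀ r, gradSq Ω u X

/-- `H(r) = r^{-n} ∫_{∂B_r(X₀)} ∑ᵢ uᵢ² dσ`. -/
def heightH {n k : ℕ} (X₀ : Pt n) (u : Fin k → Pt n → ℝ) (r : ℝ) : ℝ :=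
  (1 / r ^ n) * sphereIntegral X₀ r (fun X => ∑ i, u i X ^ 2)

/-- The Almgren frequency `N(r) = E(r) / H(r)`. -/
def frequencyN {n k : ℕ} (Ω : Set (Pt n)) (X₀ : Pt n) (u : Fin k → Pt n → ℝ) (r : ℝ) : ℝ :=
  energyE Ω X₀ u r / heightH X₀ u r

/-- Absolute continuity of `f` on a (not necessarily closed) interval `s`. -/
def AbsContOn (f : ℝ → ℝ) (s : Set ℝ) : Prop :=
  ∀ ε > (0 : ℝ), ∃ δ > (0 : ℝ), ∀ (m : ℕ) (a b : Fin m → ℝ),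
    (∀ l, a l ∈ s ∧ b l ∈ s ∧ a l ≤ b l) →
    (Pairwise fun l l' => Disjoint (Ioo (a l) (b l)) (Ioo (a l') (b l'))) →
    ∑ l, (b l - a l) < δ → ∑ l, |f (b l) - f (a l)| < ε

end Segregation

end

/-!
The argument is Almgren's. Testing the properties of a profile `u` against radial fields
`φ(|X - X₀|) (X - X₀)` and radial functions `φ(|X - X₀|)` gives three identities, collected in
`AlmgrenData`: the divergence theorem for `u²`, the energy identity coming from `uᵢ Δuᵢ = 0`, and
Pohozaev's identity coming from the domain variation formula (the `z`-component of a radial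
field is odd in `z` when `X₀` lies on the hyperplane, so the formula may be tested with it).
Letting `φ` vary and passing to polar coordinates, one finds for the spherical mean `H` and the
Dirichlet integral `D` over balls

* `H' = 2 D / rⁿ` at every radius (`AlmgrenData.hasDerivAt_sphereMean_valueSq`),
* `D = ∫ u ∂ᵣu` over almost every sphere, and Pohozaev's formula for `D'` over almost every sphere.

Hence `N` is locally absolutely continuous where `H > 0`, with derivative a positive multiple of
the spherical mean of the homogeneity defect `∑ (∇uᵢ · (X - X₀) - N uᵢ)²`
(`AlmgrenData.ae_hasDerivAt_freq`). So `N` is nondecreasing; since it is bounded up to the outer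
radius, it is absolutely continuous on the whole interval. Monotonicity of `N` bounds the growth of
`log H`, so `H` cannot vanish at one radius without vanishing identically
(`AlmgrenData.eq_zero_of_sphereMean_eq_zero`).

The energy identity needs an integration by parts across the nodal set, whose regularity is unknown:
`HarmonicWithParts.of_nonneg` gives it, by truncating the nonnegative functions `uᵢ`
near their zero sets. The nodal set lies in a hyperplane, hence is null, so the weak gradient agrees
almost everywhere with the classical one.

If `N = γ` on an interval, the defect vanishes and Euler's identity `∇uᵢ · (X - X₀) = γ uᵢ` holds in
an annulus, where `uᵢ` is therefore homogeneous along rays. For `t` close to `1` the function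
`Y ↦ uᵢ(X₀ + tY) - t^γ uᵢ(X₀ + Y)` is harmonic in the open upper half ball and vanishes on
part of the annulus. Unique continuation makes it vanish in the half ball; it is a second
application of the same frequency argument, to a single harmonic function
(`eq_zero_of_harmonicOnNhd`). Iterating gives every ratio `t`, symmetry gives the lower half ball,
and continuity gives the hyperplane.
-/

open MeasureTheory Set Metric
open scoped ContDiff

noncomputable section

namespace Segregation

/-! ### Radial cutoffs and absolutely continuous functions of one variable -/

/-- Smooth functions on `ℝ` that are constant near `(-∞, 0]` and vanish near `[R, ∞)`. Composed with
`X ↦ ‖X - X₀‖` they are the smooth radial cutoffs of the ball `B_R(X₀)`. -/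
structure RadialCutoff (R : ℝ) (φ : ℝ → ℝ) : Prop where
  smooth : ContDiff ℝ ∞ φ
  flat : ∃ ε > 0, ∀ s ≤ ε, φ s = φ 0
  vanish : ∃ R' < R, ∀ s, R' ≤ s → φ s = 0

lemma exists_bounds_of_isCompact_subset_Ioo {K : Set ℝ} {R : ℝ} (hR : 0 < R) (hK : IsCompact K)
    (hKR : K ⊆ Ioo 0 R) : ∃ a b, 0 < a ∧ b < R ∧ K ⊆ Icc a b := by
  have h1 : IsCompact (insert (R / 2) K) := hK.insert _
  have h2 : insert (R / 2) K ⊆ Ioo 0 R := insert_subset ⟨by linarith, by linarith⟩ hKR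
  obtain ⟨a, ha, ha'⟩ := h1.exists_isLeast (insert_nonempty _ _)
  obtain ⟨b, hb, hb'⟩ := h1.exists_isGreatest (insert_nonempty _ _)
  exact ⟨a, b, (h2 ha).1, (h2 hb).2, fun x hx =>
    ⟨ha' (mem_insert_of_mem _ hx), hb' (mem_insert_of_mem _ hx)⟩⟩

/-- Every test function on `(0, R)` is the derivative of a radial cutoff. -/
lemma exists_radialCutoff_deriv_eq {R : ℝ} (hR : 0 < R) {θ : ℝ → ℝ} (hθ : ContDiff ℝ ∞ θ)
    (hc : HasCompactSupport θ) (hs : tsupport θ ⊆ Ioo 0 R) :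
    ∃ φ, RadialCutoff R φ ∧ deriv φ = θ := by
  obtain ⟨a, b, ha, hb, hab⟩ := exists_bounds_of_isCompact_subset_Ioo hR hc hs
  have hz : ∀ x, x ∉ Icc a b → θ x = 0 := fun x hx =>
    image_eq_zero_of_notMem_tsupport fun h => hx (hab h)
  have hcont : Continuous θ := hθ.continuous
  have hd : ∀ r, HasDerivAt (fun r => ∫ s in R..r, θ s) (θ r) r := fun r =>
    intervalIntegral.integral_hasDerivAt_right (hcont.intervalIntegrable _ _)
      (hcont.stronglyMeasurableAtFilter _ _) hcont.continuousAt
  have hderiv : deriv (fun r => ∫ s in R..r, θ s) = θ := funext fun r => (hd r).deriv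
  refine ⟨fun r => ∫ s in R..r, θ s, ⟨?_, ⟨a / 2, by linarith, fun s hs' => ?_⟩,
    ⟨(b + R) / 2, by linarith, fun s hs' => ?_⟩⟩, hderiv⟩
  · rw [contDiff_infty_iff_deriv, hderiv]
    exact ⟨fun r => (hd r).differentiableAt, hθ⟩
  · have h0 : ∫ t in (0 : ℝ)..s, θ t = 0 := by
      apply intervalIntegral.integral_zero_ae
      refine Filter.Eventually.of_forall fun x hx => hz x fun hx' => ?_
      rcases le_max_iff.1 hx.2 with h | h <;> linarith [hx'.1]
    have := intervalIntegral.integral_add_adjacent_intervals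
      (hcont.intervalIntegrable (μ := volume) R 0) (hcont.intervalIntegrable 0 s)
    simp only [← this, h0, add_zero]
  · apply intervalIntegral.integral_zero_ae
    refine Filter.Eventually.of_forall fun x hx => hz x fun hx' => ?_
    rcases min_lt_iff.1 hx.1 with h | h <;> linarith [hx'.2]

/-- The one-dimensional distributional identity `∫ φ f = ∫ φ' g` for all radial cutoffs says that
`g` is, up to the sign, the primitive of `f` vanishing at `0`. -/
lemma ae_eq_neg_integral_of_forall_cutoff {R : ℝ} (hR : 0 < R) {f g : ℝ → ℝ}
    (hf : IntegrableOn f (Ioo 0 R)) (hg : LocallyIntegrableOn g (Ioo 0 R))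
    (h : ∀ φ, RadialCutoff R φ →
      ∫ r in Ioo 0 R, φ r * f r = ∫ r in Ioo 0 R, deriv φ r * g r) :
    ∀ᵐ r, r ∈ Ioo 0 R → g r = - ∫ s in (0 : ℝ)..r, f s := by
  have hfi : IntervalIntegrable f volume 0 R :=
    (intervalIntegrable_iff_integrableOn_Ioo_of_le hR.le).2 hf
  set F : ℝ → ℝ := fun r => ∫ s in (0 : ℝ)..r, f s with hF
  have hFac : AbsolutelyContinuousOnInterval F 0 R :=
    hfi.absolutelyContinuousOnInterval_intervalIntegral (by simp)
  have hFc : ContinuousOn F (Ioo 0 R) := hFac.continuousOn.mono (by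
    rw [uIcc_of_le hR.le]; exact Ioo_subset_Icc_self)
  have key := isOpen_Ioo.ae_eq_zero_of_integral_contDiff_smul_eq_zero (μ := volume)
    (f := fun r => g r + F r) (U := Ioo 0 R)
    (hg.add (hFc.locallyIntegrableOn measurableSet_Ioo)) ?_
  · filter_upwards [key] with r hr hr'
    linarith [hr hr']
  intro θ hθ hc hs
  obtain ⟨φ, hφ, hφθ⟩ := exists_radialCutoff_deriv_eq hR hθ hc hs
  have hφac : AbsolutelyContinuousOnInterval φ 0 R :=
    (hφ.smooth.of_le (by exact_mod_cast le_top)).contDiffOn.absolutelyContinuousOnInterval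
  have h1 := hφac.integral_mul_deriv_eq_deriv_mul hFac
  have hφR : φ R = 0 := by
    obtain ⟨R', hR', hv⟩ := hφ.vanish
    exact hv R hR'.le
  have hF0 : F 0 = 0 := by simp [hF]
  rw [hφR, hF0] at h1
  have h2 : ∫ x in (0 : ℝ)..R, φ x * deriv F x = ∫ x in (0 : ℝ)..R, φ x * f x := by
    apply intervalIntegral.integral_congr_ae
    filter_upwards [hfi.ae_hasDerivAt_integral] with x hx hx'
    rw [(hx (uIoc_subset_uIcc hx') 0 (by simp)).deriv]
  rw [h2, intervalIntegral.integral_of_le hR.le, intervalIntegral.integral_of_le hR.le,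
    integral_Ioc_eq_integral_Ioo, integral_Ioc_eq_integral_Ioo, h φ hφ, hφθ] at h1
  have h3 : ∫ x, θ x • (g x + F x) = ∫ x in Ioo 0 R, θ x • (g x + F x) := by
    rw [setIntegral_eq_integral_of_forall_compl_eq_zero]
    intro x hx
    rw [image_eq_zero_of_notMem_tsupport fun h => hx (hs h), zero_smul]
  have hi : ∀ G : ℝ → ℝ, LocallyIntegrableOn G (Ioo 0 R) →
      IntegrableOn (fun x => θ x * G x) (Ioo 0 R) := by
    intro G hG
    have h4 : IntegrableOn (fun x => θ x * G x) (tsupport θ) :=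
      (hG.integrableOn_compact_subset hs hc).continuousOn_mul hθ.continuous.continuousOn hc
    have h5 : Integrable (fun x => θ x * G x) := by
      rw [← integrableOn_iff_integrable_of_support_subset (s := tsupport θ)]
      · exact h4
      · intro x hx
        by_contra hx'
        exact hx (by simp [image_eq_zero_of_notMem_tsupport hx'])
    exact h5.integrableOn
  rw [h3]
  simp only [smul_eq_mul, mul_add]
  rw [integral_add (hi g hg) (hi F (hFc.locallyIntegrableOn measurableSet_Ioo)), h1]
  ring

/-- A bounded monotone function on `(0, R)` that is the integral of its derivative on compact
subintervals is absolutely continuous on all of `(0, R)`. -/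
lemma absContOn_of_monotoneOn_of_bounded {R M : ℝ} (hR : 0 < R) {N : ℝ → ℝ}
    (hmono : MonotoneOn N (Ioo 0 R)) (h0 : ∀ r ∈ Ioo 0 R, 0 ≤ N r)
    (hM : ∀ r ∈ Ioo 0 R, N r ≤ M)
    (hint : ∀ a ∈ Ioo 0 R, ∀ b ∈ Ioo 0 R, a ≤ b → N b - N a = ∫ r in a..b, deriv N r) :
    AbsContOn N (Ioo 0 R) := by
  classical
  -- the derivative is integrable up to both ends, since `N` extends monotonically to `[0, R]`
  set N' : ℝ → ℝ := fun r => if r ≤ 0 then 0 else if r < R then N r else max M 0 with hN'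
  have hN'eq : ∀ r ∈ Ioo 0 R, N' r = N r := fun r hr => by
    simp [hN', not_le.2 hr.1, hr.2]
  have hmono' : MonotoneOn N' (uIcc 0 R) := by
    intro x hx y hy hxy
    simp only [hN']
    split_ifs with h1 h2 h3 h4 h5 h6
    · exact le_rfl
    · exact h0 y ⟨not_le.1 h2, h3⟩
    · exact le_max_right _ _
    · linarith
    · exact hmono ⟨not_le.1 h1, h4⟩ ⟨not_le.1 h5, h6⟩ hxy
    · exact (hM x ⟨not_le.1 h1, h4⟩).trans (le_max_left _ _)
    · linarith
    · linarith
    · exact le_rfl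
  have hdi := hmono'.intervalIntegrable_deriv
  have hac := hdi.absolutelyContinuousOnInterval_intervalIntegral (c := 0) (by simp)
  rw [absolutelyContinuousOnInterval_iff] at hac
  intro ε hε
  obtain ⟨δ, hδ, H⟩ := hac ε hε
  refine ⟨δ, hδ, fun m a b hab hdisj hsum => ?_⟩
  have hderiv : ∀ r ∈ Ioo 0 R, deriv N r = deriv N' r := fun r hr => by
    apply Filter.EventuallyEq.deriv_eq
    filter_upwards [isOpen_Ioo.mem_nhds hr] with s hs using (hN'eq s hs).symm
  have hdiff : ∀ l, N (b l) - N (a l) =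
      (∫ r in (0 : ℝ)..b l, deriv N' r) - ∫ r in (0 : ℝ)..a l, deriv N' r := fun l => by
    obtain ⟨h1, h2, h3⟩ := hab l
    rw [hint _ h1 _ h2 h3, intervalIntegral.integral_interval_sub_left
      (hdi.mono_set (uIcc_subset_uIcc (by simp) (by simp [uIcc_of_le hR.le, h2.1.le, h2.2.le])))
      (hdi.mono_set (uIcc_subset_uIcc (by simp) (by simp [uIcc_of_le hR.le, h1.1.le, h1.2.le])))]
    apply intervalIntegral.integral_congr
    intro r hr
    rw [uIcc_of_le h3] at hr
    exact hderiv r ⟨h1.1.trans_le hr.1, hr.2.trans_lt h2.2⟩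
  let I : ℕ → ℝ × ℝ := fun j => if h : j < m then (a ⟨j, h⟩, b ⟨j, h⟩) else (0, 0)
  have hI : ∀ l : Fin m, I l = (a l, b l) := fun l => by simp [I]
  have key := H (m, I) ⟨?_, ?_⟩ ?_
  · rw [Finset.sum_range (n := m)] at key
    refine lt_of_eq_of_lt ?_ key
    refine Finset.sum_congr rfl fun l _ => ?_
    simp only [hI]
    rw [hdiff, dist_comm, Real.dist_eq]
  · intro j hj
    have hj' : j < m := Finset.mem_range.1 hj
    obtain ⟨h1, h2, -⟩ := hab ⟨j, hj'⟩
    simp only [I, hj', dif_pos, uIcc_of_le hR.le]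
    exact ⟨Ioo_subset_Icc_self h1, Ioo_subset_Icc_self h2⟩
  · intro i hi j hj hij
    have hi' : i < m := by simpa using hi
    have hj' : j < m := by simpa using hj
    have hne : (⟨i, hi'⟩ : Fin m) ≠ ⟨j, hj'⟩ := fun h => hij (Fin.mk.inj_iff.1 h)
    have hd : Disjoint (Ioo (a ⟨i, hi'⟩) (b ⟨i, hi'⟩)) (Ioo (a ⟨j, hj'⟩) (b ⟨j, hj'⟩)) := hdisj hne
    simp only [Function.onFun, I, hi', hj', dif_pos, uIoc_of_le (hab _).2.2]
    rw [Set.disjoint_left] at hd ⊢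
    intro x hx hx'
    have hlt : max (a ⟨i, hi'⟩) (a ⟨j, hj'⟩) < x := max_lt hx.1 hx'.1
    obtain ⟨y, hy1, hy2⟩ := exists_between hlt
    exact hd ⟨(le_max_left _ _).trans_lt hy1, hy2.trans_le hx.2⟩
      ⟨(le_max_right _ _).trans_lt hy1, hy2.trans_le hx'.2⟩
  · rw [Finset.sum_range (n := m)]
    refine lt_of_eq_of_lt ?_ hsum
    refine Finset.sum_congr rfl fun l _ => ?_
    simp only [hI]
    rw [dist_comm, Real.dist_eq, abs_of_nonneg (by linarith [(hab l).2.2])]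

/-! ### Polar coordinates and spherical means -/

/-- `∫_S F(X₀ + ρξ) dξ`, the integral of `F` over the sphere of radius `ρ` about `X₀` against the
surface measure of the unit sphere. -/
def sphereMean {n : ℕ} (X₀ : Pt n) (F : Pt n → ℝ) (ρ : ℝ) : ℝ :=
  ∫ ξ : sphere (0 : Pt n) 1, F (X₀ + ρ • (ξ : Pt n)) ∂(volume.toSphere)

lemma norm_smul_sphere {n : ℕ} {ρ : ℝ} (hρ : 0 ≤ ρ) (ξ : sphere (0 : Pt n) 1) :
    ‖ρ • (ξ : Pt n)‖ = ρ := by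
  have : ‖(ξ : Pt n)‖ = 1 := by simp
  rw [norm_smul, this, mul_one, Real.norm_of_nonneg hρ]

lemma add_smul_sphere_mem_ball {n : ℕ} {X₀ : Pt n} {ρ R : ℝ} (hρ : ρ ∈ Ioo 0 R)
    (ξ : sphere (0 : Pt n) 1) : X₀ + ρ • (ξ : Pt n) ∈ ball X₀ R := by
  rw [mem_ball, dist_eq_norm, add_sub_cancel_left, norm_smul_sphere hρ.1.le]
  exact hρ.2

/-- Integration in polar coordinates for a function on the whole space, centred at the origin. -/
lemma polar_of_integrable {n : ℕ} {F : Pt n → ℝ} (hF : Integrable F) :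
    (∀ᵐ ρ, ρ ∈ Ioi (0 : ℝ) →
      Integrable (fun ξ : sphere (0 : Pt n) 1 => F (ρ • (ξ : Pt n))) volume.toSphere) ∧
    IntegrableOn (fun ρ => ρ ^ n * sphereMean 0 F ρ) (Ioi 0) ∧
    ∫ X, F X = ∫ ρ in Ioi (0 : ℝ), ρ ^ n * sphereMean 0 F ρ := by
  have hdim : Module.finrank ℝ (Pt n) - 1 = n := by simp
  have hmp := (volume : Measure (Pt n)).measurePreserving_homeomorphUnitSphereProd
  rw [hdim] at hmp
  have hemb := (homeomorphUnitSphereProd (Pt n)).measurableEmbedding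
  set G : sphere (0 : Pt n) 1 × Ioi (0 : ℝ) → ℝ := fun p => F ((p.2 : ℝ) • (p.1 : Pt n)) with hG
  have hGF : G ∘ homeomorphUnitSphereProd (Pt n) = fun x : ({0}ᶜ : Set (Pt n)) => F x := by
    funext x
    have := homeomorphUnitSphereProd_symm_apply_coe (Pt n) (homeomorphUnitSphereProd (Pt n) x)
    rw [Homeomorph.symm_apply_apply] at this
    simp only [hG, Function.comp_apply]
    rw [← this]
  have hmeas : MeasurableSet ({0}ᶜ : Set (Pt n)) := (measurableSet_singleton _).compl
  have hGi : Integrable G (volume.toSphere.prod (Measure.volumeIoiPow n)) := by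
    rw [← hmp.integrable_comp_emb hemb, hGF]
    exact (integrableOn_iff_comap_subtypeVal hmeas).1 hF.integrableOn
  have hint : ∫ X, F X = ∫ p, G p ∂(volume.toSphere.prod (Measure.volumeIoiPow n)) := by
    rw [← hmp.integral_comp hemb]
    change _ = ∫ x, (G ∘ homeomorphUnitSphereProd (Pt n)) x ∂_
    rw [hGF, integral_subtype_comap hmeas fun x => F x, restrict_compl_singleton]
  have hpow : ∀ r : Ioi (0 : ℝ), ((r : ℝ) ^ n) = ((Real.toNNReal ((r : ℝ) ^ n) : NNReal) : ℝ) :=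
    fun r => (Real.coe_toNNReal _ (pow_nonneg (le_of_lt r.2) _)).symm
  have hmeasp : Measurable fun r : Ioi (0 : ℝ) => Real.toNNReal ((r : ℝ) ^ n) :=
    (measurable_subtype_coe.pow_const _).real_toNNReal
  have hvol : Measure.volumeIoiPow n = (Measure.comap Subtype.val volume).withDensity
      (fun r : Ioi (0 : ℝ) => ((Real.toNNReal ((r : ℝ) ^ n) : NNReal) : ENNReal)) := rfl
  refine ⟨?_, ?_, ?_⟩
  · have h1 := hGi.prod_left_ae
    rw [hvol, ae_withDensity_iff (by fun_prop)] at h1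
    have h2 := (ae_restrict_iff_subtype (μ := (volume : Measure ℝ)) (s := Ioi (0:ℝ)) measurableSet_Ioi
      (p := fun ρ => Integrable (fun ξ : sphere (0 : Pt n) 1 => F (ρ • (ξ : Pt n)))
        volume.toSphere)).2 ?_
    · exact (ae_restrict_iff' measurableSet_Ioi).1 h2
    · filter_upwards [h1] with r hr
      refine hr ?_
      have : 0 < (r : ℝ) ^ n := pow_pos r.2 n
      simpa using this
  · have h1 := hGi.integral_prod_right
    rw [hvol, integrable_withDensity_iff_integrable_smul hmeasp] at h1
    rw [integrableOn_iff_comap_subtypeVal measurableSet_Ioi]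
    refine h1.congr (Filter.Eventually.of_forall fun r => ?_)
    simp only [NNReal.smul_def, smul_eq_mul, ← hpow, Function.comp, sphereMean, zero_add, hG]
  · rw [hint, integral_prod_symm _ hGi, hvol, integral_withDensity_eq_integral_smul hmeasp,
      ← integral_subtype_comap measurableSet_Ioi]
    refine integral_congr_ae (Filter.Eventually.of_forall fun r => ?_)
    simp only [NNReal.smul_def, smul_eq_mul, ← hpow, sphereMean, zero_add, hG]

/-- Integration in polar coordinates over a ball. -/
lemma polar_ball {n : ℕ} {X₀ : Pt n} {R : ℝ} {F : Pt n → ℝ} (hF : IntegrableOn F (ball X₀ R)) :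
    (∀ᵐ ρ, ρ ∈ Ioo 0 R →
      Integrable (fun ξ : sphere (0 : Pt n) 1 => F (X₀ + ρ • (ξ : Pt n))) volume.toSphere) ∧
    IntegrableOn (fun ρ => ρ ^ n * sphereMean X₀ F ρ) (Ioo 0 R) ∧
    ∫ X in ball X₀ R, F X = ∫ ρ in Ioo 0 R, ρ ^ n * sphereMean X₀ F ρ := by
  set F' : Pt n → ℝ := fun X => (ball X₀ R).indicator F (X₀ + X) with hF'
  have hi : Integrable F' := by
    have := (integrable_indicator_iff measurableSet_ball).2 hF
    exact this.comp_add_left X₀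
  obtain ⟨h1, h2, h3⟩ := polar_of_integrable hi
  have hin : ∀ ρ ∈ Ioo 0 R, ∀ ξ : sphere (0 : Pt n) 1,
      F' (ρ • (ξ : Pt n)) = F (X₀ + ρ • (ξ : Pt n)) := fun ρ hρ ξ =>
    indicator_of_mem (add_smul_sphere_mem_ball hρ ξ) _
  have hout : ∀ ρ ∈ Ioi (0 : ℝ) \ Ioo 0 R, sphereMean 0 F' ρ = 0 := by
    intro ρ hρ
    have hR : R ≤ ρ := by
      by_contra h
      exact hρ.2 ⟨hρ.1, not_le.1 h⟩
    have : ∀ ξ : sphere (0 : Pt n) 1, F' (ρ • (ξ : Pt n)) = 0 := fun ξ => by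
      apply indicator_of_notMem
      rw [mem_ball, dist_eq_norm, add_sub_cancel_left, norm_smul_sphere (le_of_lt hρ.1)]
      exact not_lt.2 hR
    simp [sphereMean, this]
  have hmean : ∀ ρ ∈ Ioo 0 R, sphereMean 0 F' ρ = sphereMean X₀ F ρ := fun ρ hρ => by
    simp only [sphereMean, zero_add, hin ρ hρ]
  refine ⟨?_, ?_, ?_⟩
  · filter_upwards [h1] with ρ hρ hρ'
    simpa only [hin ρ hρ'] using hρ hρ'.1
  · refine (h2.mono_set Ioo_subset_Ioi_self).congr_fun (fun ρ hρ => ?_) measurableSet_Ioo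
    simp only [hmean ρ hρ]
  · have h4 : ∫ X in ball X₀ R, F X = ∫ X, F' X := by
      rw [← integral_indicator measurableSet_ball]
      exact (integral_add_left_eq_self (fun X => (ball X₀ R).indicator F X) X₀).symm
    rw [h4, h3, setIntegral_eq_of_subset_of_forall_sdiff_eq_zero measurableSet_Ioi
      Ioo_subset_Ioi_self (fun ρ hρ => by rw [hout ρ hρ, mul_zero])]
    exact setIntegral_congr_fun measurableSet_Ioo fun ρ hρ => by simp only [hmean ρ hρ]

/-- Radial weights pass through polar coordinates. -/
lemma integral_ball_radial_mul {n : ℕ} {X₀ : Pt n} {R : ℝ} {F : Pt n → ℝ} {w : ℝ → ℝ}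
    (hF : IntegrableOn F (ball X₀ R)) (hw : Continuous w) :
    IntegrableOn (fun X => w ‖X - X₀‖ * F X) (ball X₀ R) ∧
    IntegrableOn (fun ρ => w ρ * (ρ ^ n * sphereMean X₀ F ρ)) (Ioo 0 R) ∧
    ∫ X in ball X₀ R, w ‖X - X₀‖ * F X =
      ∫ ρ in Ioo 0 R, w ρ * (ρ ^ n * sphereMean X₀ F ρ) := by
  have hi : IntegrableOn (fun X => w ‖X - X₀‖ * F X) (ball X₀ R) := by
    obtain ⟨c, hc⟩ := (isCompact_closedBall X₀ R).exists_bound_of_continuousOn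
      (f := fun X => w ‖X - X₀‖) (by fun_prop)
    refine Integrable.bdd_mul (c := c) hF ?_ ?_
    · exact (by fun_prop : Continuous fun X => w ‖X - X₀‖).aestronglyMeasurable
    · exact (ae_restrict_iff' measurableSet_ball).2
        (Filter.Eventually.of_forall fun X hX => hc X (ball_subset_closedBall hX))
  obtain ⟨-, h2, h3⟩ := polar_ball hi
  have h4 : ∀ ρ ∈ Ioo 0 R, ρ ^ n * sphereMean X₀ (fun X => w ‖X - X₀‖ * F X) ρ =
      w ρ * (ρ ^ n * sphereMean X₀ F ρ) := fun ρ hρ => by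
    simp only [sphereMean, add_sub_cancel_left, norm_smul_sphere hρ.1.le, integral_const_mul]
    ring
  refine ⟨hi, h2.congr_fun h4 measurableSet_Ioo, ?_⟩
  rw [h3]
  exact setIntegral_congr_fun measurableSet_Ioo h4

/-! ### Almgren's radial identities -/

lemma RadialCutoff.continuous_deriv {R : ℝ} {φ : ℝ → ℝ} (h : RadialCutoff R φ) :
    Continuous (deriv φ) :=
  h.smooth.continuous_deriv (by exact_mod_cast le_top)

lemma RadialCutoff.deriv_eq_zero {R : ℝ} {φ : ℝ → ℝ} (h : RadialCutoff R φ) :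
    ∃ ε > 0, ∀ s < ε, deriv φ s = 0 := by
  obtain ⟨ε, hε, hf⟩ := h.flat
  refine ⟨ε, hε, fun s hs => ?_⟩
  have : φ =ᶠ[nhds s] fun _ => φ 0 := by
    filter_upwards [Iio_mem_nhds hs] with t ht using hf t ht.le
  rw [this.deriv_eq, deriv_const]

lemma RadialCutoff.continuous_deriv_div {R : ℝ} {φ : ℝ → ℝ} (h : RadialCutoff R φ) :
    Continuous fun ρ => deriv φ ρ / ρ := by
  obtain ⟨ε, hε, hz⟩ := h.deriv_eq_zero
  rw [continuous_iff_continuousAt]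
  intro s
  by_cases hs : s < ε
  · have : (fun ρ => deriv φ ρ / ρ) =ᶠ[nhds s] fun _ => 0 := by
      filter_upwards [Iio_mem_nhds hs] with t ht
      rw [hz t ht, zero_div]
    exact continuousAt_const.congr this.symm
  · exact h.continuous_deriv.continuousAt.div continuousAt_id (by change s ≠ 0; linarith)

section RadialIdentities

variable {n k : ℕ}

/-- `∑ uᵢ²`. -/
def valueSq (u : Fin k → Pt n → ℝ) (X : Pt n) : ℝ := ∑ i, u i X ^ 2

/-- `∑ uᵢ ∇uᵢ · (X - X₀)`, with `g` in the role of the gradients. -/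
def crossRad (X₀ : Pt n) (u : Fin k → Pt n → ℝ) (g : Fin k → Pt n → Pt n) (X : Pt n) : ℝ :=
  ∑ i, u i X * inner ℝ (g i X) (X - X₀)

/-- `∑ (∇uᵢ · (X - X₀))²`, with `g` in the role of the gradients. -/
def radialSq (X₀ : Pt n) (g : Fin k → Pt n → Pt n) (X : Pt n) : ℝ :=
  ∑ i, inner ℝ (g i X) (X - X₀) ^ 2

/-- `∑ |∇uᵢ|²`, with `g` in the role of the gradients. -/
def fieldSq (g : Fin k → Pt n → Pt n) (X : Pt n) : ℝ := ∑ i, ‖g i X‖ ^ 2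

/-- What Almgren's argument uses of a vector function `u` with gradients `g` on `B_R(X₀)`: three
integral identities tested against radial cutoffs `φ(|X - X₀|)`. They express that `g` is the
gradient of `u` in radial directions (`value_parts`), that `uᵢ Δuᵢ = 0` (`energy_parts`), and
stationarity under radial domain variations (`pohozaev`). -/
structure AlmgrenData (X₀ : Pt n) (R : ℝ) (u : Fin k → Pt n → ℝ) (g : Fin k → Pt n → Pt n) :
    Prop where
  cont : ∀ i, ContinuousOn (u i) (ball X₀ R)
  memLp_val : ∀ i, MemLp (u i) 2 (volume.restrict (ball X₀ R))
  memLp_grad : ∀ i, MemLp (g i) 2 (volume.restrict (ball X₀ R))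
  value_parts : ∀ φ, RadialCutoff R φ → ∫ X in ball X₀ R,
    (((n + 1) * φ ‖X - X₀‖ + ‖X - X₀‖ * deriv φ ‖X - X₀‖) * valueSq u X +
      2 * φ ‖X - X₀‖ * crossRad X₀ u g X) = 0
  energy_parts : ∀ φ, RadialCutoff R φ → ∫ X in ball X₀ R,
    (φ ‖X - X₀‖ * fieldSq g X + deriv φ ‖X - X₀‖ / ‖X - X₀‖ * crossRad X₀ u g X) = 0
  pohozaev : ∀ φ, RadialCutoff R φ → ∫ X in ball X₀ R,
    (((1 - n) / 2 * φ ‖X - X₀‖ - ‖X - X₀‖ * deriv φ ‖X - X₀‖ / 2) * fieldSq g X +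
      deriv φ ‖X - X₀‖ / ‖X - X₀‖ * radialSq X₀ g X) = 0

namespace AlmgrenData

variable {X₀ : Pt n} {R : ℝ} {u : Fin k → Pt n → ℝ} {g : Fin k → Pt n → Pt n}

lemma integrableOn_valueSq (h : AlmgrenData X₀ R u g) : IntegrableOn (valueSq u) (ball X₀ R) :=
  integrable_finsetSum _ fun i _ => (h.memLp_val i).integrable_sq

lemma integrableOn_fieldSq (h : AlmgrenData X₀ R u g) : IntegrableOn (fieldSq g) (ball X₀ R) :=
  integrable_finsetSum _ fun i _ => (h.memLp_grad i).norm.integrable_sq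

lemma memLp_inner (h : AlmgrenData X₀ R u g) (i : Fin k) :
    MemLp (fun X => inner ℝ (g i X) (X - X₀)) 2 (volume.restrict (ball X₀ R)) := by
  refine (h.memLp_grad i).of_le_mul (c := R) ?_ ?_
  · exact (h.memLp_grad i).1.inner (by fun_prop : Continuous fun X => X - X₀).aestronglyMeasurable
  · refine (ae_restrict_iff' measurableSet_ball).2 (Filter.Eventually.of_forall fun X hX => ?_)
    rw [mem_ball, dist_eq_norm] at hX
    calc ‖inner ℝ (g i X) (X - X₀)‖ ≤ ‖g i X‖ * ‖X - X₀‖ := norm_inner_le_norm _ _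
      _ ≤ ‖g i X‖ * R := by gcongr
      _ = R * ‖g i X‖ := mul_comm _ _

lemma integrableOn_crossRad (h : AlmgrenData X₀ R u g) :
    IntegrableOn (crossRad X₀ u g) (ball X₀ R) :=
  integrable_finsetSum _ fun i _ => (h.memLp_val i).integrable_mul (h.memLp_inner i)

lemma integrableOn_radialSq (h : AlmgrenData X₀ R u g) :
    IntegrableOn (radialSq X₀ g) (ball X₀ R) :=
  integrable_finsetSum _ fun i _ => (h.memLp_inner i).integrable_sq

lemma continuousOn_sphereMean_valueSq (h : AlmgrenData X₀ R u g) :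
    ContinuousOn (sphereMean X₀ (valueSq u)) (Ioo 0 R) := by
  have hc : ContinuousOn (valueSq u) (ball X₀ R) :=
    continuousOn_finsetSum _ fun i _ => (h.cont i).pow 2
  intro r hr
  refine ContinuousAt.continuousWithinAt ?_
  obtain ⟨b, hb1, hb2⟩ := exists_between hr.2
  obtain ⟨c, hcb⟩ := (isCompact_closedBall X₀ b).exists_bound_of_continuousOn
    (hc.mono (closedBall_subset_ball hb2))
  have hnhds : Ioo 0 b ∈ nhds r := isOpen_Ioo.mem_nhds ⟨hr.1, hb1⟩
  have hcomp : ∀ ρ ∈ Ioo 0 R, Continuous fun ξ : sphere (0 : Pt n) 1 =>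
      valueSq u (X₀ + ρ • (ξ : Pt n)) := fun ρ hρ =>
    hc.comp_continuous (by fun_prop) fun ξ => add_smul_sphere_mem_ball hρ ξ
  refine continuousAt_of_dominated (bound := fun _ => c) ?_ ?_ (integrable_const c) ?_
  · filter_upwards [hnhds] with ρ hρ
    exact (hcomp ρ ⟨hρ.1, hρ.2.trans hb2⟩).aestronglyMeasurable
  · filter_upwards [hnhds] with ρ hρ
    exact Filter.Eventually.of_forall fun ξ =>
      hcb _ (ball_subset_closedBall (add_smul_sphere_mem_ball hρ ξ))
  · refine Filter.Eventually.of_forall fun ξ => ?_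
    exact ContinuousAt.comp (f := fun ρ : ℝ => X₀ + ρ • (ξ : Pt n)) (g := valueSq u)
      (hc.continuousAt (isOpen_ball.mem_nhds (add_smul_sphere_mem_ball hr ξ))) (by fun_prop)

/-- The integral `∫_{B_r(X₀)} |∇u|²`. -/
def dirichlet (X₀ : Pt n) (g : Fin k → Pt n → Pt n) (r : ℝ) : ℝ := ∫ X in ball X₀ r, fieldSq g X

lemma dirichlet_nonneg (r : ℝ) : 0 ≤ dirichlet X₀ g r :=
  integral_nonneg fun _ => Finset.sum_nonneg fun _ _ => sq_nonneg _

lemma dirichlet_eq (h : AlmgrenData X₀ R u g) {r : ℝ} (hr : r ∈ Ioo 0 R) :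
    dirichlet X₀ g r = ∫ s in (0 : ℝ)..r, s ^ n * sphereMean X₀ (fieldSq g) s := by
  rw [intervalIntegral.integral_of_le hr.1.le, integral_Ioc_eq_integral_Ioo]
  exact (polar_ball (h.integrableOn_fieldSq.mono_set (ball_subset_ball hr.2.le))).2.2

lemma intervalIntegrable_fieldSq (h : AlmgrenData X₀ R u g) (hR : 0 < R) :
    IntervalIntegrable (fun s => s ^ n * sphereMean X₀ (fieldSq g) s) volume 0 R :=
  (intervalIntegrable_iff_integrableOn_Ioo_of_le hR.le).2 (polar_ball h.integrableOn_fieldSq).2.1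

lemma locallyIntegrableOn_mul {w F : ℝ → ℝ} (hF : IntegrableOn F (Ioo 0 R))
    (hw : ContinuousOn w (Ioo 0 R)) : LocallyIntegrableOn (fun r => w r * F r) (Ioo 0 R) :=
  hF.locallyIntegrableOn.continuousOn_mul hw isOpen_Ioo.isLocallyClosed

/-- `∫_{B_r} |∇u|² = ∫_{∂B_r} u ∂_ν u` for almost every `r`. -/
lemma ae_dirichlet_eq (h : AlmgrenData X₀ R u g) (hR : 0 < R) :
    ∀ᵐ r, r ∈ Ioo 0 R → r⁻¹ * (r ^ n * sphereMean X₀ (crossRad X₀ u g) r) = dirichlet X₀ g r := by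
  have hD := h.integrableOn_fieldSq
  have hB := h.integrableOn_crossRad
  have key := ae_eq_neg_integral_of_forall_cutoff hR (polar_ball hD).2.1
    (g := fun r => -r⁻¹ * (r ^ n * sphereMean X₀ (crossRad X₀ u g) r))
    (locallyIntegrableOn_mul (polar_ball hB).2.1
      (continuousOn_inv₀.neg.mono fun r hr => hr.1.ne')) ?_
  · filter_upwards [key] with r hr hr'
    rw [h.dirichlet_eq hr', ← neg_inj, ← hr hr']
    ring
  · intro φ hφ
    obtain ⟨i1, -, e1⟩ := integral_ball_radial_mul hD hφ.smooth.continuous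
    obtain ⟨i2, -, e2⟩ := integral_ball_radial_mul hB hφ.continuous_deriv_div
    have := h.energy_parts φ hφ
    rw [integral_add i1 i2, e1, e2] at this
    rw [eq_neg_of_add_eq_zero_left this, ← integral_neg]
    congr 1; ext r; ring

/-- The Pohozaev identity on `B_r`, for almost every `r`. -/
lemma ae_pohozaev (h : AlmgrenData X₀ R u g) (hR : 0 < R) :
    ∀ᵐ r, r ∈ Ioo 0 R → r⁻¹ * (r ^ n * sphereMean X₀ (radialSq X₀ g) r) -
      r / 2 * (r ^ n * sphereMean X₀ (fieldSq g) r) = (1 - n) / 2 * dirichlet X₀ g r := by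
  have hD := h.integrableOn_fieldSq
  have hC := h.integrableOn_radialSq
  have key := ae_eq_neg_integral_of_forall_cutoff hR
    (f := fun r => (1 - n) / 2 * (r ^ n * sphereMean X₀ (fieldSq g) r))
    ((polar_ball hD).2.1.const_mul _)
    (g := fun r => -r⁻¹ * (r ^ n * sphereMean X₀ (radialSq X₀ g) r) +
      r / 2 * (r ^ n * sphereMean X₀ (fieldSq g) r))
    ((locallyIntegrableOn_mul (polar_ball hC).2.1
      (continuousOn_inv₀.neg.mono fun r hr => hr.1.ne')).add
      (locallyIntegrableOn_mul (polar_ball hD).2.1 (by fun_prop))) ?_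
  · filter_upwards [key] with r hr hr'
    rw [h.dirichlet_eq hr', ← intervalIntegral.integral_const_mul, ← neg_inj, ← hr hr']
    ring
  · intro φ hφ
    have c2 : Continuous fun ρ => ρ * deriv φ ρ / 2 :=
      (continuous_id.mul hφ.continuous_deriv).div_const 2
    have c1 : Continuous fun ρ => (1 - n) / 2 * φ ρ := continuous_const.mul hφ.smooth.continuous
    obtain ⟨-, j1, -⟩ := integral_ball_radial_mul hD c1
    obtain ⟨-, j2, -⟩ := integral_ball_radial_mul hD c2
    have c12 : Continuous fun ρ => (1 - n) / 2 * φ ρ - ρ * deriv φ ρ / 2 := c1.sub c2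
    obtain ⟨i1, -, e1⟩ := integral_ball_radial_mul hD c12
    obtain ⟨i2, j3, e2⟩ := integral_ball_radial_mul hC hφ.continuous_deriv_div
    have := h.pohozaev φ hφ
    rw [integral_add i1 i2, e1, e2] at this
    simp only [sub_mul] at this
    rw [integral_sub j1 j2] at this
    have e3 : ∫ r in Ioo 0 R, deriv φ r * (-r⁻¹ * (r ^ n * sphereMean X₀ (radialSq X₀ g) r) +
      r / 2 * (r ^ n * sphereMean X₀ (fieldSq g) r)) =
      - (∫ r in Ioo 0 R, deriv φ r / r * (r ^ n * sphereMean X₀ (radialSq X₀ g) r)) +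
      ∫ r in Ioo 0 R, r * deriv φ r / 2 * (r ^ n * sphereMean X₀ (fieldSq g) r) := by
      rw [← integral_neg, ← integral_add (by exact j3.neg) j2]
      congr 1; ext r; ring
    rw [e3]
    have e4 : ∫ r in Ioo 0 R, φ r * ((1 - n) / 2 * (r ^ n * sphereMean X₀ (fieldSq g) r)) =
      ∫ r in Ioo 0 R, (1 - n) / 2 * φ r * (r ^ n * sphereMean X₀ (fieldSq g) r) := by
      congr 1; ext r; ring
    rw [e4]
    linarith

/-- The divergence theorem for `∑ uᵢ²` on `B_r`, for almost every `r`, with the volume terms in polar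
coordinates and the boundary integral of `u ∂_ν u` replaced by the Dirichlet integral. -/
lemma ae_value_eq (h : AlmgrenData X₀ R u g) (hR : 0 < R) :
    ∀ᵐ r, r ∈ Ioo 0 R → r * (r ^ n * sphereMean X₀ (valueSq u) r) =
      ∫ s in (0 : ℝ)..r, ((n + 1) * (s ^ n * sphereMean X₀ (valueSq u) s) +
        2 * (s * dirichlet X₀ g s)) := by
  have hA := h.integrableOn_valueSq
  have hB := h.integrableOn_crossRad
  have key := ae_eq_neg_integral_of_forall_cutoff hR
    (f := fun r => (n + 1) * (r ^ n * sphereMean X₀ (valueSq u) r) +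
      2 * (r ^ n * sphereMean X₀ (crossRad X₀ u g) r))
    (((polar_ball hA).2.1.const_mul _).add ((polar_ball hB).2.1.const_mul _))
    (g := fun r => -r * (r ^ n * sphereMean X₀ (valueSq u) r))
    (locallyIntegrableOn_mul (polar_ball hA).2.1 (by fun_prop)) ?_
  · filter_upwards [key] with r hr hr'
    rw [← neg_inj, ← neg_mul, hr hr', neg_inj]
    apply intervalIntegral.integral_congr_ae
    filter_upwards [h.ae_dirichlet_eq hR] with s hs hs'
    rw [uIoc_of_le hr'.1.le] at hs'
    rw [← hs ⟨hs'.1, hs'.2.trans_lt hr'.2⟩, mul_inv_cancel_left₀ hs'.1.ne']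
  · intro φ hφ
    have c1 : Continuous fun ρ => (n + 1) * φ ρ := continuous_const.mul hφ.smooth.continuous
    have c2 : Continuous fun ρ => ρ * deriv φ ρ := continuous_id.mul hφ.continuous_deriv
    have c3 : Continuous fun ρ => 2 * φ ρ := continuous_const.mul hφ.smooth.continuous
    obtain ⟨-, j1, -⟩ := integral_ball_radial_mul hA c1
    obtain ⟨-, j2, -⟩ := integral_ball_radial_mul hA c2
    have c12 : Continuous fun ρ => (n + 1) * φ ρ + ρ * deriv φ ρ := c1.add c2
    obtain ⟨i1, -, e1⟩ := integral_ball_radial_mul hA c12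
    obtain ⟨i2, j3, e2⟩ := integral_ball_radial_mul hB c3
    have e0 : ∫ ρ in Ioo 0 R, ((n + 1) * φ ρ + ρ * deriv φ ρ) *
        (ρ ^ n * sphereMean X₀ (valueSq u) ρ) =
        (∫ ρ in Ioo 0 R, (n + 1) * φ ρ * (ρ ^ n * sphereMean X₀ (valueSq u) ρ)) +
        ∫ ρ in Ioo 0 R, ρ * deriv φ ρ * (ρ ^ n * sphereMean X₀ (valueSq u) ρ) := by
      rw [← integral_add j1 j2]
      congr 1; ext r; ring
    have := h.value_parts φ hφ
    rw [integral_add i1 i2, e1, e2, e0] at this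
    have e3 : ∫ r in Ioo 0 R, φ r * ((n + 1) * (r ^ n * sphereMean X₀ (valueSq u) r) +
      2 * (r ^ n * sphereMean X₀ (crossRad X₀ u g) r)) =
      (∫ r in Ioo 0 R, (n + 1) * φ r * (r ^ n * sphereMean X₀ (valueSq u) r)) +
      ∫ r in Ioo 0 R, 2 * φ r * (r ^ n * sphereMean X₀ (crossRad X₀ u g) r) := by
      rw [← integral_add j1 j3]
      congr 1; ext r; ring
    have e4 : ∫ r in Ioo 0 R, deriv φ r * (-r * (r ^ n * sphereMean X₀ (valueSq u) r)) =
      - ∫ r in Ioo 0 R, r * deriv φ r * (r ^ n * sphereMean X₀ (valueSq u) r) := by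
      rw [← integral_neg]
      congr 1; ext r; ring
    rw [e3, e4]
    linarith

lemma continuousOn_dirichlet (h : AlmgrenData X₀ R u g) (hR : 0 < R) :
    ContinuousOn (dirichlet X₀ g) (Ioo 0 R) := by
  have h1 := ((h.intervalIntegrable_fieldSq hR).absolutelyContinuousOnInterval_intervalIntegral
    (c := 0) (by simp)).continuousOn
  rw [uIcc_of_le hR.le] at h1
  exact (h1.mono Ioo_subset_Icc_self).congr fun r hr => h.dirichlet_eq hr

/-- `H'(r) = 2 r⁻ⁿ ∫_{B_r} |∇u|²`, at every radius. -/
lemma hasDerivAt_sphereMean_valueSq (h : AlmgrenData X₀ R u g) {r : ℝ} (hr : r ∈ Ioo 0 R) :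
    HasDerivAt (sphereMean X₀ (valueSq u)) (2 * dirichlet X₀ g r / r ^ n) r := by
  have hR : 0 < R := hr.1.trans hr.2
  have hHc := h.continuousOn_sphereMean_valueSq
  set H := sphereMean X₀ (valueSq u) with hH
  set q : ℝ → ℝ := fun s => (n + 1) * (s ^ n * H s) + 2 * (s * dirichlet X₀ g s) with hq
  have hqc : ContinuousOn q (Ioo 0 R) := by
    have := h.continuousOn_dirichlet hR
    fun_prop
  have hqi : ∀ s ∈ Ioo 0 R, IntervalIntegrable q volume 0 s := by
    intro s hs
    rw [intervalIntegrable_iff_integrableOn_Ioo_of_le hs.1.le]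
    have i1 : IntegrableOn (fun s => (n + 1) * (s ^ n * H s)) (Ioo 0 s) :=
      ((polar_ball h.integrableOn_valueSq).2.1.mono_set (Ioo_subset_Ioo_right hs.2.le)).const_mul _
    have i2 : IntegrableOn (fun s => 2 * (s ^ n * sphereMean X₀ (crossRad X₀ u g) s)) (Ioo 0 s) :=
      ((polar_ball h.integrableOn_crossRad).2.1.mono_set
        (Ioo_subset_Ioo_right hs.2.le)).const_mul _
    refine (i1.add i2).congr ((ae_restrict_iff' measurableSet_Ioo).2 ?_)
    filter_upwards [h.ae_dirichlet_eq hR] with t ht ht'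
    simp only [hq, Pi.add_apply]
    rw [← ht ⟨ht'.1, ht'.2.trans hs.2⟩, mul_inv_cancel_left₀ ht'.1.ne']
  have hqd : ∀ s ∈ Ioo 0 R, HasDerivAt (fun s => ∫ t in (0 : ℝ)..s, q t) (q s) s := fun s hs =>
    intervalIntegral.integral_hasDerivAt_right (hqi s hs)
      (hqc.stronglyMeasurableAtFilter isOpen_Ioo s hs) (hqc.continuousAt (isOpen_Ioo.mem_nhds hs))
  -- both sides are continuous, so the identity for almost every radius holds at every radius
  have hP : EqOn (fun s => s * (s ^ n * H s)) (fun s => ∫ t in (0 : ℝ)..s, q t) (Ioo 0 R) := by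
    refine Measure.eqOn_open_of_ae_eq (μ := volume) ?_ isOpen_Ioo (by fun_prop)
      fun s hs => (hqd s hs).continuousAt.continuousWithinAt
    exact (ae_restrict_iff' measurableSet_Ioo).2 (h.ae_value_eq hR)
  have hP' : ∀ s ∈ Ioo 0 R, s * (s ^ n * H s) = ∫ t in (0 : ℝ)..s, q t := fun s hs => hP hs
  have h1 := (hqd r hr).div (hasDerivAt_pow (n + 1) r) (pow_ne_zero _ hr.1.ne')
  refine (h1.congr_of_eventuallyEq ?_).congr_deriv ?_
  · filter_upwards [isOpen_Ioo.mem_nhds hr] with s hs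
    simp only [Pi.div_apply]
    rw [← hP' _ hs]
    have := hs.1.ne'
    field_simp
    ring
  · rw [← hP' _ hr]
    have := hr.1.ne'
    simp only [hq, Nat.add_sub_cancel, Nat.cast_add, Nat.cast_one]
    field_simp
    ring

end AlmgrenData

end RadialIdentities

/-! ### The frequency function -/

lemma _root_.AbsolutelyContinuousOnInterval.congr {f f' : ℝ → ℝ} {a b : ℝ}
    (hf : AbsolutelyContinuousOnInterval f a b) (h : EqOn f f' (uIcc a b)) :
    AbsolutelyContinuousOnInterval f' a b := by
  rw [absolutelyContinuousOnInterval_iff] at hf ⊢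
  intro ε hε
  obtain ⟨δ, hδ, H⟩ := hf ε hε
  refine ⟨δ, hδ, fun I hI hlt => ?_⟩
  refine lt_of_eq_of_lt (Finset.sum_congr rfl fun i hi => ?_) (H I hI hlt)
  rw [h (hI.1 i hi).1, h (hI.1 i hi).2]

lemma absolutelyContinuousOnInterval_of_hasDerivAt {f f' : ℝ → ℝ} {a b : ℝ}
    (h : ∀ x ∈ uIcc a b, HasDerivAt f (f' x) x) (hc : ContinuousOn f' (uIcc a b)) :
    AbsolutelyContinuousOnInterval f a b := by
  obtain ⟨c, hcb⟩ := isCompact_uIcc.exists_bound_of_continuousOn hc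
  refine LipschitzOnWith.absolutelyContinuousOnInterval (K := c.toNNReal) ?_
  refine (convex_uIcc a b).lipschitzOnWith_of_nnnorm_hasDerivWithin_le (f' := f')
    (fun x hx => (h x hx).hasDerivWithinAt) fun x hx => ?_
  rw [← NNReal.coe_le_coe, coe_nnnorm]
  exact (hcb x hx).trans (Real.le_coe_toNNReal c)

namespace AlmgrenData

variable {n k : ℕ} {X₀ : Pt n} {R : ℝ} {u : Fin k → Pt n → ℝ} {g : Fin k → Pt n → Pt n}

/-- Almgren's frequency `E(r) / H(r)`. The factor `r / r ^ n` stands for `r^(-(n-1))`, which avoids a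
truncated or negative exponent. -/
def freq (X₀ : Pt n) (u : Fin k → Pt n → ℝ) (g : Fin k → Pt n → Pt n) (r : ℝ) : ℝ :=
  dirichlet X₀ g r * (r / r ^ n / sphereMean X₀ (valueSq u) r)

/-- `∑ (∇uᵢ · (X - X₀) - c uᵢ)²`, which vanishes for functions homogeneous of degree `c`. -/
def homDefect (X₀ : Pt n) (u : Fin k → Pt n → ℝ) (g : Fin k → Pt n → Pt n) (c : ℝ) (X : Pt n) :
    ℝ :=
  ∑ i, (inner ℝ (g i X) (X - X₀) - c * u i X) ^ 2

lemma homDefect_eq (c : ℝ) (X : Pt n) : homDefect X₀ u g c X =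
    radialSq X₀ g X - 2 * c * crossRad X₀ u g X + c ^ 2 * valueSq u X := by
  simp only [homDefect, radialSq, crossRad, valueSq, Finset.mul_sum, ← Finset.sum_sub_distrib,
    ← Finset.sum_add_distrib]
  exact Finset.sum_congr rfl fun i _ => by ring

lemma integrableOn_homDefect (h : AlmgrenData X₀ R u g) (c : ℝ) :
    IntegrableOn (homDefect X₀ u g c) (ball X₀ R) := by
  have := (h.integrableOn_radialSq.sub (h.integrableOn_crossRad.const_mul (2 * c))).add
    (h.integrableOn_valueSq.const_mul (c ^ 2))
  exact this.congr (Filter.Eventually.of_forall fun X => by simp [homDefect_eq])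

lemma sphereMean_nonneg {F : Pt n → ℝ} (hF : ∀ X, 0 ≤ F X) (r : ℝ) : 0 ≤ sphereMean X₀ F r :=
  integral_nonneg fun _ => hF _

lemma sphereMean_valueSq_nonneg (r : ℝ) : 0 ≤ sphereMean X₀ (valueSq u) r :=
  sphereMean_nonneg (fun _ => Finset.sum_nonneg fun _ _ => sq_nonneg _) r

lemma sphereMean_homDefect_nonneg (c r : ℝ) : 0 ≤ sphereMean X₀ (homDefect X₀ u g c) r :=
  sphereMean_nonneg (fun _ => Finset.sum_nonneg fun _ _ => sq_nonneg _) r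

lemma ae_sphereMean_homDefect (h : AlmgrenData X₀ R u g) :
    ∀ᵐ r, r ∈ Ioo 0 R → ∀ c, sphereMean X₀ (homDefect X₀ u g c) r =
      sphereMean X₀ (radialSq X₀ g) r - 2 * c * sphereMean X₀ (crossRad X₀ u g) r +
        c ^ 2 * sphereMean X₀ (valueSq u) r := by
  filter_upwards [(polar_ball h.integrableOn_radialSq).1, (polar_ball h.integrableOn_crossRad).1,
    (polar_ball h.integrableOn_valueSq).1] with r h1 h2 h3 hr c
  simp only [sphereMean, homDefect_eq]
  rw [integral_add (by exact (h1 hr).sub ((h2 hr).const_mul _)) ((h3 hr).const_mul _),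
    integral_sub (h1 hr) ((h2 hr).const_mul _), integral_const_mul, integral_const_mul]

lemma hasDerivAt_weight (h : AlmgrenData X₀ R u g) {r : ℝ} (hr : r ∈ Ioo 0 R)
    (hH : 0 < sphereMean X₀ (valueSq u) r) :
    HasDerivAt (fun r => r / r ^ n / sphereMean X₀ (valueSq u) r)
      ((1 - n) / r ^ n / sphereMean X₀ (valueSq u) r -
        r / r ^ n * (2 * dirichlet X₀ g r / r ^ n) / sphereMean X₀ (valueSq u) r ^ 2) r := by
  have hr0 := hr.1.ne'
  have h1 := ((hasDerivAt_id r).div (hasDerivAt_pow n r) (pow_ne_zero _ hr0)).div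
    (h.hasDerivAt_sphereMean_valueSq hr) hH.ne'
  refine h1.congr_deriv ?_
  have h2 : (n : ℝ) * r ^ (n - 1) * r = n * r ^ n := by
    rcases n with _ | m
    · simp
    · rw [Nat.add_sub_cancel, mul_assoc, ← pow_succ]
  have h3 : (1 * r ^ n - r * (n * r ^ (n - 1))) = (1 - n) * r ^ n := by linarith
  simp only [id, Pi.div_apply, h3]
  have := hH.ne'
  field_simp

/-- The derivative of the frequency is a positive multiple of the mean of the homogeneity defect: this
is the Cauchy-Schwarz step of Almgren's computation, in the form of an identity. -/
lemma ae_hasDerivAt_freq (h : AlmgrenData X₀ R u g) (hR : 0 < R) :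
    ∀ᵐ r, r ∈ Ioo 0 R → 0 < sphereMean X₀ (valueSq u) r →
      HasDerivAt (freq X₀ u g) (2 / (r * sphereMean X₀ (valueSq u) r) *
        sphereMean X₀ (homDefect X₀ u g (freq X₀ u g r)) r) r := by
  filter_upwards [h.ae_sphereMean_homDefect, h.ae_dirichlet_eq hR, h.ae_pohozaev hR,
    (h.intervalIntegrable_fieldSq hR).ae_hasDerivAt_integral] with r h1 h2 h3 h4 hr hH
  have hr' : r ∈ uIcc 0 R := by rw [uIcc_of_le hR.le]; exact Ioo_subset_Icc_self hr
  have hD : HasDerivAt (dirichlet X₀ g) (r ^ n * sphereMean X₀ (fieldSq g) r) r :=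
    (h4 hr' 0 (by simp)).congr_of_eventuallyEq <| by
      filter_upwards [isOpen_Ioo.mem_nhds hr] with s hs using h.dirichlet_eq hs
  refine (hD.mul (h.hasDerivAt_weight hr hH)).congr_deriv ?_
  have hr0 := hr.1.ne'
  have hrn : r ^ n ≠ 0 := pow_ne_zero _ hr0
  rw [h1 hr]
  have hC : sphereMean X₀ (radialSq X₀ g) r =
      r / r ^ n * ((1 - n) / 2 * dirichlet X₀ g r + r / 2 * (r ^ n * sphereMean X₀ (fieldSq g) r)) := by
    rw [← h3 hr]; field_simp; ring
  have hB : sphereMean X₀ (crossRad X₀ u g) r = r / r ^ n * dirichlet X₀ g r := by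
    rw [← h2 hr]; field_simp
  rw [hC, hB]
  simp only [freq]
  generalize sphereMean X₀ (valueSq u) r = H at hH ⊢
  have := hH.ne'
  field_simp
  ring

lemma absolutelyContinuous_freq (h : AlmgrenData X₀ R u g) {a b : ℝ} (ha : 0 < a) (hab : a ≤ b)
    (hb : b < R) (hH : ∀ r ∈ Icc a b, 0 < sphereMean X₀ (valueSq u) r) :
    AbsolutelyContinuousOnInterval (freq X₀ u g) a b := by
  have hR : 0 < R := by linarith
  have hsub : ∀ r ∈ Icc a b, r ∈ Ioo 0 R := fun r hr => ⟨ha.trans_le hr.1, hr.2.trans_lt hb⟩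
  have hD : AbsolutelyContinuousOnInterval (dirichlet X₀ g) a b := by
    refine (((h.intervalIntegrable_fieldSq hR).absolutelyContinuousOnInterval_intervalIntegral
      (c := 0) (by simp)).mono ?_).congr fun r hr => ?_
    · rw [uIcc_of_le hR.le, uIcc_of_le hab]
      exact Icc_subset_Icc ha.le hb.le
    · rw [uIcc_of_le hab] at hr
      exact (h.dirichlet_eq (hsub r hr)).symm
  refine hD.fun_mul (absolutelyContinuousOnInterval_of_hasDerivAt
    (fun r hr => h.hasDerivAt_weight (hsub r ?_) (hH r ?_)) ?_)
  · rwa [uIcc_of_le hab] at hr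
  · rwa [uIcc_of_le hab] at hr
  · rw [uIcc_of_le hab]
    have hc1 := (h.continuousOn_dirichlet hR).mono hsub
    have hc2 := h.continuousOn_sphereMean_valueSq.mono hsub
    have hne : ∀ r ∈ Icc a b, sphereMean X₀ (valueSq u) r ≠ 0 := fun r hr => (hH r hr).ne'
    have hne2 : ∀ r ∈ Icc a b, r ^ n ≠ 0 := fun r hr => pow_ne_zero _ (hsub r hr).1.ne'
    have hne3 : ∀ r ∈ Icc a b, sphereMean X₀ (valueSq u) r ^ 2 ≠ 0 := fun r hr =>
      pow_ne_zero _ (hne r hr)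
    have c0 : ContinuousOn (fun r : ℝ => r ^ n) (Icc a b) := by fun_prop
    exact ((continuousOn_const.div c0 hne2).div hc2 hne).sub
      ((((continuousOn_id.div c0 hne2).mul ((continuousOn_const.mul hc1).div c0 hne2))).div
        (hc2.pow 2) hne3)

lemma freq_sub_eq (h : AlmgrenData X₀ R u g) {a b : ℝ} (ha : 0 < a) (hab : a ≤ b)
    (hb : b < R) (hH : ∀ r ∈ Icc a b, 0 < sphereMean X₀ (valueSq u) r) :
    freq X₀ u g b - freq X₀ u g a = ∫ r in a..b, deriv (freq X₀ u g) r :=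
  (h.absolutelyContinuous_freq ha hab hb hH).integral_deriv_eq_sub.symm

lemma freq_le (h : AlmgrenData X₀ R u g) {a b : ℝ} (ha : 0 < a) (hab : a ≤ b)
    (hb : b < R) (hH : ∀ r ∈ Icc a b, 0 < sphereMean X₀ (valueSq u) r) :
    freq X₀ u g a ≤ freq X₀ u g b := by
  rw [← sub_nonneg, h.freq_sub_eq ha hab hb hH]
  apply intervalIntegral.integral_nonneg_of_ae_restrict hab
  rw [Filter.EventuallyLE, ae_restrict_iff' measurableSet_Icc]
  filter_upwards [h.ae_hasDerivAt_freq (by linarith)] with r hr hr'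
  have hr0 : 0 < r := ha.trans_le hr'.1
  rw [(hr ⟨hr0, hr'.2.trans_lt hb⟩ (hH r hr')).deriv]
  have := hH r hr'
  exact mul_nonneg (by positivity) (sphereMean_homDefect_nonneg _ _)

lemma freq_nonneg {r : ℝ} (hr : 0 < r) : 0 ≤ freq X₀ u g r :=
  mul_nonneg (dirichlet_nonneg r) (div_nonneg (by positivity) (sphereMean_valueSq_nonneg r))

lemma monotoneOn_sphereMean_valueSq (h : AlmgrenData X₀ R u g) :
    MonotoneOn (sphereMean X₀ (valueSq u)) (Ioo 0 R) := by
  refine monotoneOn_of_deriv_nonneg (convex_Ioo 0 R) h.continuousOn_sphereMean_valueSq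
    (fun r hr => ?_) fun r hr => ?_
  · rw [interior_Ioo] at hr
    exact (h.hasDerivAt_sphereMean_valueSq hr).differentiableAt.differentiableWithinAt
  · rw [interior_Ioo] at hr
    rw [(h.hasDerivAt_sphereMean_valueSq hr).deriv]
    have := hr.1
    exact div_nonneg (mul_nonneg zero_le_two (dirichlet_nonneg r)) (by positivity)

/-- If `H` vanishes at one radius it vanishes at every radius: otherwise the monotone, hence bounded,
frequency would bound `(log H)'` to the right of the last zero of `H`. -/
lemma sphereMean_valueSq_eq_zero (h : AlmgrenData X₀ R u g) {r₁ r₂ : ℝ} (hr₁ : r₁ ∈ Ioo 0 R)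
    (hr₂ : r₂ ∈ Ioo 0 R) (h0 : sphereMean X₀ (valueSq u) r₁ = 0) :
    sphereMean X₀ (valueSq u) r₂ = 0 := by
  have hHc := h.continuousOn_sphereMean_valueSq
  have hmono := h.monotoneOn_sphereMean_valueSq
  set H := sphereMean X₀ (valueSq u) with hHdef
  have hH0 : ∀ r, 0 ≤ H r := sphereMean_valueSq_nonneg
  by_contra hne
  have hpos : 0 < H r₂ := lt_of_le_of_ne (hH0 r₂) (Ne.symm hne)
  have hlt : r₁ < r₂ := by
    by_contra hle
    have := hmono hr₂ hr₁ (not_lt.1 hle)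
    linarith
  have hsub : Icc r₁ r₂ ⊆ Ioo 0 R := fun r hr => ⟨hr₁.1.trans_le hr.1, hr.2.trans_lt hr₂.2⟩
  have hcpt : IsCompact (Icc r₁ r₂ ∩ H ⁻¹' {0}) :=
    isCompact_Icc.of_isClosed_subset
      ((hHc.mono hsub).preimage_isClosed_of_isClosed isClosed_Icc isClosed_singleton)
      inter_subset_left
  -- `c` is the last zero of `H` in `[r₁, r₂]`
  obtain ⟨c, ⟨hc, hc0⟩, hcmax⟩ := hcpt.exists_isGreatest ⟨r₁, ⟨le_rfl, hlt.le⟩, h0⟩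
  have hHcz : H c = 0 := hc0
  have hcr : c < r₂ := lt_of_le_of_ne hc.2 fun e => hne (by rw [← e]; exact hHcz)
  have hcpos : 0 < c := (hsub hc).1
  have hHp : ∀ r ∈ Ioc c r₂, 0 < H r := fun r hr =>
    lt_of_le_of_ne (hH0 r) fun e => not_le.2 hr.1 (hcmax ⟨⟨hc.1.trans hr.1.le, hr.2⟩, e.symm⟩)
  -- `K` bounds `(log H)' = 2 N / r` on `(c, r₂)`
  set K := 2 * freq X₀ u g r₂ / c with hK
  have hanti : AntitoneOn (fun r => H r * Real.exp (-K * r)) (Icc c r₂) := by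
    have hsub' : Icc c r₂ ⊆ Ioo 0 R := (Icc_subset_Icc_left hc.1).trans hsub
    have hd : ∀ r ∈ Ioo c r₂, HasDerivAt (fun r => H r * Real.exp (-K * r))
        (2 * dirichlet X₀ g r / r ^ n * Real.exp (-K * r) +
          H r * (Real.exp (-K * r) * (-K * 1))) r := fun r hr =>
      (h.hasDerivAt_sphereMean_valueSq (hsub' (Ioo_subset_Icc_self hr))).mul
        (((hasDerivAt_id r).const_mul (-K)).exp)
    refine antitoneOn_of_deriv_nonpos (convex_Icc _ _)
      ((hHc.mono hsub').mul (by fun_prop)) ?_ ?_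
    · rw [interior_Icc]
      exact fun r hr => (hd r hr).differentiableAt.differentiableWithinAt
    · rw [interior_Icc]
      intro r hr
      rw [(hd r hr).deriv]
      have hr0 : 0 < r := hcpos.trans hr.1
      have hf := h.freq_le hr0 hr.2.le hr₂.2 fun s hs => hHp s ⟨hr.1.trans_le hs.1, hs.2⟩
      have hHr := hHp r ⟨hr.1, hr.2.le⟩
      have e1 : 2 * dirichlet X₀ g r / r ^ n = 2 * freq X₀ u g r / r * H r := by
        simp only [freq, ← hHdef]
        have := hHr.ne'
        field_simp
      have e2 : 2 * freq X₀ u g r / r ≤ K := by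
        rw [hK]
        have : 0 ≤ freq X₀ u g r := freq_nonneg hr0
        have hrc := hr.1.le
        gcongr
        linarith
      rw [e1]
      have : 0 ≤ (K - 2 * freq X₀ u g r / r) * (H r * Real.exp (-K * r)) :=
        mul_nonneg (by linarith) (by positivity)
      linarith
  have := hanti ⟨le_rfl, hcr.le⟩ ⟨hcr.le, le_rfl⟩ hcr.le
  simp only [hHcz, zero_mul] at this
  have : 0 < H r₂ * Real.exp (-K * r₂) := by positivity
  linarith

/-- Vanishing on one sphere forces vanishing in the whole ball. -/
lemma eq_zero_of_sphereMean_eq_zero (h : AlmgrenData X₀ R u g) {r : ℝ} (hr : r ∈ Ioo 0 R)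
    (h0 : sphereMean X₀ (valueSq u) r = 0) (i : Fin k) {X : Pt n} (hX : X ∈ ball X₀ R) :
    u i X = 0 := by
  have hc : ContinuousOn (valueSq u) (ball X₀ R) :=
    continuousOn_finsetSum _ fun i _ => (h.cont i).pow 2
  have hne : ∀ X ∈ ball X₀ R, X ≠ X₀ → u i X = 0 := by
    intro X hX hXne
    have hρ : ‖X - X₀‖ ∈ Ioo 0 R :=
      ⟨norm_pos_iff.2 (sub_ne_zero.2 hXne), by rwa [mem_ball, dist_eq_norm] at hX⟩
    have hz := h.sphereMean_valueSq_eq_zero hr hρ h0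
    have hcomp : Continuous fun ξ : sphere (0 : Pt n) 1 =>
        valueSq u (X₀ + ‖X - X₀‖ • (ξ : Pt n)) :=
      hc.comp_continuous (by fun_prop) fun ξ => add_smul_sphere_mem_ball hρ ξ
    have hnn : ∀ Y, 0 ≤ valueSq u Y := fun _ => Finset.sum_nonneg fun _ _ => sq_nonneg _
    have hae := (integral_eq_zero_iff_of_nonneg (fun ξ => hnn _)
      (hcomp.integrable_of_hasCompactSupport (HasCompactSupport.of_compactSpace _))).1 hz
    have hall := (hcomp.ae_eq_iff_eq (volume : Measure (Pt n)).toSphere continuous_zero).1 hae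
    have hξ : ‖X - X₀‖⁻¹ • (X - X₀) ∈ sphere (0 : Pt n) 1 := by
      rw [mem_sphere_zero_iff_norm, norm_smul, norm_inv, norm_norm, inv_mul_cancel₀ hρ.1.ne']
    have hval := congrFun hall ⟨_, hξ⟩
    simp only [smul_inv_smul₀ hρ.1.ne', add_sub_cancel, Pi.zero_apply, valueSq] at hval
    have := (Finset.sum_eq_zero_iff_of_nonneg fun j _ => sq_nonneg (u j X)).1 hval i
      (Finset.mem_univ i)
    exact pow_eq_zero_iff two_ne_zero |>.1 this
  -- polar coordinates miss the centre, where continuity is used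
  by_cases hXe : X = X₀
  · have hball : ball X₀ R ∈ nhds X₀ := isOpen_ball.mem_nhds (mem_ball_self (hr.1.trans hr.2))
    have h1 : Filter.Tendsto (u i) (nhdsWithin X₀ {X₀}ᶜ) (nhds (u i X₀)) :=
      ((h.cont i).continuousAt hball).tendsto.mono_left nhdsWithin_le_nhds
    have h2 : Filter.Tendsto (u i) (nhdsWithin X₀ {X₀}ᶜ) (nhds 0) := by
      refine tendsto_const_nhds.congr' ?_
      filter_upwards [mem_nhdsWithin_of_mem_nhds hball, self_mem_nhdsWithin] with Y hY hY'
      exact (hne Y hY hY').symm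
    rw [hXe]
    exact tendsto_nhds_unique h1 h2
  · exact hne X hX hXe

/-- Constant frequency forces the homogeneity defect to vanish almost everywhere. -/
lemma ae_inner_eq_of_freq_eq (h : AlmgrenData X₀ R u g) {γ a b : ℝ} (ha : 0 ≤ a) (hb : b ≤ R)
    (hpos : ∀ r ∈ Ioo 0 R, 0 < sphereMean X₀ (valueSq u) r)
    (hγ : ∀ r ∈ Ioo a b, freq X₀ u g r = γ) :
    ∀ᵐ X, X ∈ ball X₀ b \ closedBall X₀ a →
      ∀ i, inner ℝ (g i X) (X - X₀) = γ * u i X := by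
  by_cases hab : b ≤ a
  · refine Filter.Eventually.of_forall fun X hX => ?_
    exact absurd (ball_subset_closedBall (ball_subset_ball hab hX.1)) hX.2
  have hab : a < b := not_le.1 hab
  have hR : 0 < R := by linarith
  have hsub : Ioo a b ⊆ Ioo 0 R := Ioo_subset_Ioo ha hb
  have hmean : ∀ᵐ r, r ∈ Ioo a b → sphereMean X₀ (homDefect X₀ u g γ) r = 0 := by
    filter_upwards [h.ae_hasDerivAt_freq hR] with r hr hr'
    have hd := hr (hsub hr') (hpos r (hsub hr'))
    have hconst : HasDerivAt (freq X₀ u g) 0 r :=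
      (hasDerivAt_const r γ).congr_of_eventuallyEq <| by
        filter_upwards [isOpen_Ioo.mem_nhds hr'] with s hs using hγ s hs
    have := hd.unique hconst
    rw [hγ r hr'] at this
    refine (mul_eq_zero.1 this).resolve_left ?_
    have h1 := (hsub hr').1
    have h2 := hpos r (hsub hr')
    positivity
  -- the defect, cut down to the annulus, integrates to zero over the ball in polar coordinates
  set F : Pt n → ℝ := (closedBall X₀ a)ᶜ.indicator (homDefect X₀ u g γ) with hF
  have hFi : IntegrableOn F (ball X₀ b) :=
    ((h.integrableOn_homDefect γ).mono_set (ball_subset_ball hb)).indicator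
      measurableSet_closedBall.compl
  have hz : ∫ X in ball X₀ b, F X = 0 := by
    rw [(polar_ball hFi).2.2]
    apply setIntegral_eq_zero_of_ae_eq_zero
    filter_upwards [hmean, compl_mem_ae_iff.2 (measure_singleton a)] with r hr hra hr'
    by_cases har : a < r
    · have : sphereMean X₀ F r = sphereMean X₀ (homDefect X₀ u g γ) r := by
        refine integral_congr_ae (Filter.Eventually.of_forall fun ξ => ?_)
        refine indicator_of_mem ?_ _
        rw [mem_compl_iff, mem_closedBall, dist_eq_norm, add_sub_cancel_left,
          norm_smul_sphere hr'.1.le]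
        exact not_le.2 har
      rw [this, hr ⟨har, hr'.2⟩, mul_zero]
    · have : sphereMean X₀ F r = 0 := by
        refine integral_eq_zero_of_ae (Filter.Eventually.of_forall fun ξ => ?_)
        refine indicator_of_notMem ?_ _
        rw [mem_compl_iff, not_not, mem_closedBall, dist_eq_norm, add_sub_cancel_left,
          norm_smul_sphere hr'.1.le]
        exact not_lt.1 har
      rw [this, mul_zero]
  have hnn : ∀ X, 0 ≤ homDefect X₀ u g γ X := fun _ => Finset.sum_nonneg fun _ _ => sq_nonneg _
  have hae := (integral_eq_zero_iff_of_nonneg (fun X => indicator_nonneg (fun X _ => hnn X) X)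
    hFi).1 hz
  filter_upwards [(ae_restrict_iff' measurableSet_ball).1 hae] with X hX hX' i
  have h1 := hX hX'.1
  rw [indicator_of_mem hX'.2, Pi.zero_apply] at h1
  have := (Finset.sum_eq_zero_iff_of_nonneg fun j _ => sq_nonneg _).1 h1 i (Finset.mem_univ i)
  have := (pow_eq_zero_iff two_ne_zero).1 this
  linarith

end AlmgrenData

/-! ### Divergence, gradients and radial test fields -/

section Calculus

variable {n : ℕ}

lemma inner_eq_sum_coord (V W : Pt n) : inner ℝ V W = ∑ j, V j * W j := by
  rw [PiLp.inner_apply]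
  exact Finset.sum_congr rfl fun j _ => by simp [mul_comm]

lemma apply_eq_sum_single (ℓ : Pt n →L[ℝ] ℝ) (V : Pt n) :
    ℓ V = ∑ j, ℓ (EuclideanSpace.single j 1) * V j := by
  conv_lhs => rw [← (EuclideanSpace.basisFun (Fin (n + 1)) ℝ).sum_repr V]
  simp [map_sum, mul_comm]

lemma divergence_smul {f : Pt n → ℝ} {Q : Pt n → Pt n} {X : Pt n} (hf : DifferentiableAt ℝ f X)
    (hQ : DifferentiableAt ℝ Q X) :
    divergence (fun X => f X • Q X) X = fderiv ℝ f X (Q X) + f X * divergence Q X := by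
  simp only [divergence, fderiv_fun_smul hf hQ]
  rw [apply_eq_sum_single (fderiv ℝ f X) (Q X), Finset.mul_sum, ← Finset.sum_add_distrib]
  refine Finset.sum_congr rfl fun j _ => ?_
  simp
  ring

lemma divergence_sub {P Q : Pt n → Pt n} {X : Pt n} (hP : DifferentiableAt ℝ P X)
    (hQ : DifferentiableAt ℝ Q X) :
    divergence (fun X => P X - Q X) X = divergence P X - divergence Q X := by
  simp [divergence, fderiv_fun_sub hP hQ, Finset.sum_sub_distrib]

lemma divergence_congr {P Q : Pt n → Pt n} {X : Pt n} (h : P =ᶠ[nhds X] Q) :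
    divergence P X = divergence Q X := by
  simp [divergence, h.fderiv_eq]

lemma divergence_sub_const (X₀ X : Pt n) : divergence (fun X => X - X₀) X = n + 1 := by
  simp [divergence, fderiv_sub_const]

lemma continuous_divergence {V : Pt n → Pt n} (hV : ContDiff ℝ 1 V) : Continuous (divergence V) := by
  have := hV.continuous_fderiv one_ne_zero
  unfold divergence
  fun_prop

lemma contDiffAt_gradient {u : Pt n → ℝ} {X : Pt n} (h : ContDiffAt ℝ 2 u X) :
    ContDiffAt ℝ 1 (gradient u) X := by
  have h1 : ContDiffAt ℝ 1 (fderiv ℝ u) X := h.fderiv_right (by norm_num)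
  exact ((InnerProductSpace.toDual ℝ (Pt n)).symm.toContinuousLinearEquiv.contDiff.contDiffAt).comp
    X h1

lemma inner_fderiv_gradient {u : Pt n → ℝ} {X : Pt n} (h : ContDiffAt ℝ 2 u X) (v w : Pt n) :
    inner ℝ (fderiv ℝ (gradient u) X v) w = fderiv ℝ (fderiv ℝ u) X v w := by
  have hg : DifferentiableAt ℝ (gradient u) X := (contDiffAt_gradient h).differentiableAt one_ne_zero
  have hf : DifferentiableAt ℝ (fderiv ℝ u) X :=
    (h.fderiv_right (m := 1) (by norm_num)).differentiableAt one_ne_zero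
  have h1 : (fun Y => inner ℝ (gradient u Y) w) = fun Y => fderiv ℝ u Y w :=
    funext fun Y => inner_gradient_left
  have h2 := congrArg (fun f => fderiv ℝ f X v) h1
  rw [fderiv_inner_apply ℝ hg (differentiableAt_const w)] at h2
  rw [fderiv_clm_apply hf (differentiableAt_const w)] at h2
  simpa using h2

lemma divergence_gradient {u : Pt n → ℝ} {X : Pt n} (h : ContDiffAt ℝ 2 u X) :
    divergence (gradient u) X = Laplacian.laplacian u X := by
  rw [InnerProductSpace.laplacian_eq_iteratedFDeriv_orthonormalBasis u
    (EuclideanSpace.basisFun (Fin (n + 1)) ℝ)]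
  simp only [divergence]
  refine Finset.sum_congr rfl fun j _ => ?_
  rw [iteratedFDeriv_two_apply, EuclideanSpace.basisFun_apply]
  simp only [Matrix.cons_val_zero, Matrix.cons_val_one]
  rw [← inner_fderiv_gradient h, inner_eq_sum_coord]
  simp

lemma integral_divergence_eq_zero {V : Pt n → Pt n} (hV : ContDiff ℝ 1 V)
    (hc : HasCompactSupport V) : ∫ X, divergence V X = 0 := by
  have hcd : ∀ j : Fin (n + 1), Continuous fun X => fderiv ℝ V X (EuclideanSpace.single j 1) j := by
    have := hV.continuous_fderiv one_ne_zero
    intro j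
    fun_prop
  have hi : ∀ j : Fin (n + 1), Integrable fun X => fderiv ℝ V X (EuclideanSpace.single j 1) j := by
    refine fun j => (hcd j).integrable_of_hasCompactSupport ((hc.fderiv ℝ).mono' fun X hX => ?_)
    refine subset_tsupport _ fun h0 => hX ?_
    simp [h0]
  unfold divergence
  rw [integral_finsetSum _ fun j _ => hi j]
  refine Finset.sum_eq_zero fun j _ => ?_
  have hd : ∀ X, DifferentiableAt ℝ V X := fun X => hV.differentiable one_ne_zero X
  have hfd : ∀ X v, fderiv ℝ (fun X => V X j) X v = fderiv ℝ V X v j := fun X v => by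
    have := ((EuclideanSpace.proj (𝕜 := ℝ) j).hasFDerivAt.comp X (hd X).hasFDerivAt).fderiv
    exact congrArg (fun ℓ => ℓ v) this
  have hVj : Integrable fun X => V X j := by
    refine Continuous.integrable_of_hasCompactSupport (by have := hV.continuous; fun_prop)
      (hc.mono fun X hX h0 => hX ?_)
    simp [h0]
  have := integral_mul_fderiv_eq_neg_fderiv_mul_of_integrable (μ := (volume : Measure (Pt n)))
    (f := fun _ => (1 : ℝ)) (g := fun X => V X j) (v := EuclideanSpace.single j 1)
    (by simp) (by simpa only [hfd, one_mul] using hi j) (by simpa using hVj)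
    (fun X _ => differentiableAt_const _) (fun X _ => by
      have := hd X
      fun_prop)
  simpa [hfd] using this

lemma hasFDerivAt_norm_of_ne_zero {Z : Pt n} (hZ : Z ≠ 0) :
    HasFDerivAt (fun Z : Pt n => ‖Z‖) (‖Z‖⁻¹ • innerSL ℝ Z) Z := by
  have h1 := (hasStrictFDerivAt_norm_sq Z).hasFDerivAt.sqrt (pow_ne_zero 2 (norm_ne_zero_iff.2 hZ))
  simp only [Real.sqrt_sq (norm_nonneg _)] at h1
  refine h1.congr_fderiv ?_
  ext v
  simp only [smul_apply, innerSL_apply_apply, smul_eq_mul, nsmul_eq_mul, Nat.cast_ofNat]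
  have := norm_ne_zero_iff.2 hZ
  field_simp

lemma RadialCutoff.hasFDerivAt {R : ℝ} {φ : ℝ → ℝ} (h : RadialCutoff R φ) (X₀ X : Pt n) :
    HasFDerivAt (fun X => φ ‖X - X₀‖)
      ((deriv φ ‖X - X₀‖ / ‖X - X₀‖) • innerSL ℝ (X - X₀)) X := by
  by_cases hX : X = X₀
  · obtain ⟨ε, hε, hf⟩ := h.flat
    have : (fun X => φ ‖X - X₀‖) =ᶠ[nhds X] fun _ => φ 0 := by
      filter_upwards [ball_mem_nhds X hε] with Y hY
      rw [hX, mem_ball, dist_eq_norm] at hY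
      exact hf _ hY.le
    refine HasFDerivAt.congr_of_eventuallyEq ?_ this
    subst hX
    simpa using hasFDerivAt_const (φ 0) X
  · have h0 : HasFDerivAt (fun X : Pt n => X - X₀) (ContinuousLinearMap.id ℝ (Pt n)) X :=
      (hasFDerivAt_id X).sub_const X₀
    have h1 := (hasFDerivAt_norm_of_ne_zero (sub_ne_zero.2 hX)).comp X h0
    rw [ContinuousLinearMap.comp_id] at h1
    have h2 : HasDerivAt φ (deriv φ ‖X - X₀‖) ‖X - X₀‖ :=
      (h.smooth.differentiable (by simp)).differentiableAt.hasDerivAt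
    have h3 := h2.comp_hasFDerivAt X h1
    rwa [smul_smul, ← div_eq_mul_inv] at h3

lemma RadialCutoff.contDiff {R : ℝ} {φ : ℝ → ℝ} (h : RadialCutoff R φ) (X₀ : Pt n) :
    ContDiff ℝ ∞ fun X => φ ‖X - X₀‖ := by
  rw [contDiff_iff_contDiffAt]
  intro X
  by_cases hX : X = X₀
  · obtain ⟨ε, hε, hf⟩ := h.flat
    refine (contDiffAt_const (c := φ 0)).congr_of_eventuallyEq ?_
    filter_upwards [ball_mem_nhds X hε] with Y hY
    rw [hX, mem_ball, dist_eq_norm] at hY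
    exact hf _ hY.le
  · exact h.smooth.contDiffAt.comp X
      ((contDiffAt_id.sub contDiffAt_const).norm ℝ (sub_ne_zero.2 hX))

lemma RadialCutoff.exists_isCompact {R : ℝ} {φ : ℝ → ℝ} (h : RadialCutoff R φ) (X₀ : Pt n) :
    ∃ K ⊆ ball X₀ R, IsCompact K ∧ ∀ X ∉ K, φ ‖X - X₀‖ = 0 := by
  obtain ⟨R', hR', hv⟩ := h.vanish
  refine ⟨closedBall X₀ R', closedBall_subset_ball hR', isCompact_closedBall _ _, fun X hX => ?_⟩
  rw [mem_closedBall, dist_eq_norm, not_le] at hX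
  exact hv _ hX.le

/-- The radial vector field `φ(|X - X₀|) (X - X₀)`. -/
def radialField (φ : ℝ → ℝ) (X₀ X : Pt n) : Pt n := φ ‖X - X₀‖ • (X - X₀)

lemma RadialCutoff.contDiff_radialField {R : ℝ} {φ : ℝ → ℝ} (h : RadialCutoff R φ) (X₀ : Pt n) :
    ContDiff ℝ ∞ (radialField φ X₀) :=
  (h.contDiff X₀).smul (contDiff_id.sub contDiff_const)

lemma RadialCutoff.fderiv_radialField {R : ℝ} {φ : ℝ → ℝ} (h : RadialCutoff R φ)
    (X₀ X v : Pt n) : fderiv ℝ (radialField φ X₀) X v =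
      φ ‖X - X₀‖ • v + (deriv φ ‖X - X₀‖ / ‖X - X₀‖ * inner ℝ (X - X₀) v) • (X - X₀) := by
  have := ((h.hasFDerivAt X₀ X).smul ((hasFDerivAt_id X).sub_const X₀)).fderiv
  change fderiv ℝ (radialField φ X₀) X = _ at this
  rw [this]
  simp [inner_sub_left]

lemma RadialCutoff.divergence_radialField {R : ℝ} {φ : ℝ → ℝ} (h : RadialCutoff R φ)
    (X₀ X : Pt n) : divergence (radialField φ X₀) X =
      (n + 1) * φ ‖X - X₀‖ + ‖X - X₀‖ * deriv φ ‖X - X₀‖ := by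
  have h1 := divergence_smul (h.hasFDerivAt X₀ X).differentiableAt
    ((differentiableAt_id (𝕜 := ℝ) (x := X)).sub_const X₀)
  change divergence (radialField φ X₀) X = _ at h1
  simp only [id] at h1
  rw [h1, (h.hasFDerivAt X₀ X).fderiv, divergence_sub_const]
  simp only [smul_apply, innerSL_apply_apply, real_inner_self_eq_norm_sq, smul_eq_mul]
  by_cases h0 : ‖X - X₀‖ = 0
  · simp [h0]; ring
  · field_simp
    ring

lemma RadialCutoff.isTest_radialField {R : ℝ} {φ : ℝ → ℝ} (h : RadialCutoff R φ) (X₀ : Pt n) :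
    IsTest (ball X₀ R) (radialField φ X₀) := by
  obtain ⟨K, hKR, hK, hz⟩ := h.exists_isCompact X₀
  have hz' : ∀ X ∉ K, radialField φ X₀ X = 0 := fun X hX => by
    rw [radialField, hz X hX, zero_smul]
  refine ⟨h.contDiff_radialField X₀, HasCompactSupport.intro hK hz', ?_⟩
  refine (closure_minimal (fun X hX => ?_) hK.isClosed).trans hKR
  by_contra hX'
  exact hX (hz' X hX')

end Calculus

/-! ### Integration by parts across the nodal set -/

section Parts

variable {n k : ℕ}

/-- `u` is a function on `Ω`, harmonic on an open set `W ⊆ Ω` of full measure, such that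
`div (u Q)` integrates to zero even for compactly supported fields `Q` which are `C¹` on `W` only. -/
structure HarmonicWithParts (Ω W : Set (Pt n)) (u : Pt n → ℝ) : Prop where
  isOpen : IsOpen W
  subset : W ⊆ Ω
  null : volume (Ω \ W) = 0
  harmonic : InnerProductSpace.HarmonicOnNhd u W
  cont : ContinuousOn u Ω
  memLp_val : MemLp u 2 (volume.restrict Ω)
  memLp_grad : MemLp (gradient u) 2 (volume.restrict Ω)
  parts : ∀ (Q : Pt n → Pt n) (K : Set (Pt n)), ContDiffOn ℝ 1 Q W → IsCompact K → K ⊆ Ω →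
    (∀ X ∉ K, Q X = 0) → IntegrableOn (fun X => inner ℝ (gradient u X) (Q X)) Ω →
    IntegrableOn (fun X => u X * divergence Q X) Ω →
    ∫ X in Ω, (inner ℝ (gradient u X) (Q X) + u X * divergence Q X) = 0

lemma setIntegral_divergence_eq_zero {Ω K : Set (Pt n)} {V : Pt n → Pt n} (hV : ContDiff ℝ 1 V)
    (hK : IsCompact K) (hKΩ : K ⊆ Ω) (hz : ∀ X ∉ K, V X = 0) :
    ∫ X in Ω, divergence V X = 0 := by
  rw [setIntegral_eq_integral_of_forall_compl_eq_zero]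
  · exact integral_divergence_eq_zero hV (HasCompactSupport.intro hK hz)
  · intro X hX
    have : V =ᶠ[nhds X] fun _ => 0 := by
      filter_upwards [hK.isClosed.isOpen_compl.mem_nhds fun h => hX (hKΩ h)] with Y hY using hz Y hY
    rw [divergence_congr this]
    simp [divergence]

/-- A field that is `C¹` on an open set, and vanishes near every point outside it, is `C¹`. -/
lemma contDiff_of_contDiffOn_of_eventually_zero {W : Set (Pt n)} {V : Pt n → Pt n}
    (hW : IsOpen W) (hV : ContDiffOn ℝ 1 V W) (hz : ∀ X ∉ W, V =ᶠ[nhds X] fun _ => 0) :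
    ContDiff ℝ 1 V := by
  rw [contDiff_iff_contDiffAt]
  intro X
  by_cases hX : X ∈ W
  · exact hV.contDiffAt (hW.mem_nhds hX)
  · exact contDiffAt_const.congr_of_eventuallyEq (hz X hX)

lemma HarmonicWithParts.of_harmonicOnNhd {W : Set (Pt n)} {u : Pt n → ℝ} (hW : IsOpen W)
    (hu : InnerProductSpace.HarmonicOnNhd u W) (h1 : MemLp u 2 (volume.restrict W))
    (h2 : MemLp (gradient u) 2 (volume.restrict W)) : HarmonicWithParts W W u where
  isOpen := hW
  subset := subset_rfl
  null := by simp
  harmonic := hu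
  cont := hu.contDiffOn.continuousOn
  memLp_val := h1
  memLp_grad := h2
  parts := by
    intro Q K hQ hK hKW hz _ _
    have hu2 := hu.contDiffOn
    have hV : ContDiff ℝ 1 fun X => u X • Q X := by
      refine contDiff_of_contDiffOn_of_eventually_zero hW
        ((hu2.of_le (by norm_num)).smul hQ) fun X hX => ?_
      filter_upwards [hK.isClosed.isOpen_compl.mem_nhds fun h => hX (hKW h)] with Y hY
      rw [hz Y hY, smul_zero]
    rw [← setIntegral_divergence_eq_zero hV hK hKW fun X hX => by rw [hz X hX, smul_zero]]
    refine setIntegral_congr_fun hW.measurableSet fun X hX => ?_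
    have hd1 : DifferentiableAt ℝ u X :=
      ((hu X hX).1).differentiableAt two_ne_zero
    have hd2 : DifferentiableAt ℝ Q X :=
      (hQ.contDiffAt (hW.mem_nhds hX)).differentiableAt one_ne_zero
    simp only [divergence_smul hd1 hd2, inner_gradient_left]

/-- A nonnegative continuous function, harmonic off a null set on which it vanishes, satisfies
integration by parts: cut off with `χ(u / δ)` and let `δ → 0`. -/
lemma HarmonicWithParts.of_nonneg {Ω W : Set (Pt n)} {u : Pt n → ℝ} (hΩ : IsOpen Ω)
    (hW : IsOpen W) (hWΩ : W ⊆ Ω) (hnull : volume (Ω \ W) = 0)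
    (hu : InnerProductSpace.HarmonicOnNhd u W) (hcont : ContinuousOn u Ω)
    (hnn : ∀ X ∈ Ω, 0 ≤ u X) (hzero : ∀ X ∈ Ω \ W, u X = 0)
    (h1 : MemLp u 2 (volume.restrict Ω)) (h2 : MemLp (gradient u) 2 (volume.restrict Ω)) :
    HarmonicWithParts Ω W u where
  isOpen := hW
  subset := hWΩ
  null := hnull
  harmonic := hu
  cont := hcont
  memLp_val := h1
  memLp_grad := h2
  parts := by
    intro Q K hQ hK hKΩ hQz hi1 hi2
    -- `χ = 0` on `(-∞, 1]` and `χ = 1` on `[2, ∞)`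
    set χ : ℝ → ℝ := fun t => Real.smoothTransition (t - 1) with hχ
    have hχs : ContDiff ℝ 1 χ :=
      (Real.smoothTransition.contDiff (n := 1)).comp (contDiff_id.sub contDiff_const)
    have hχ0 : ∀ t ≤ 1, χ t = 0 := fun t ht =>
      Real.smoothTransition.zero_of_nonpos (by linarith)
    have hχ1 : ∀ t, 2 ≤ t → χ t = 1 := fun t ht =>
      Real.smoothTransition.one_of_one_le (by linarith)
    have hχle : ∀ t, |χ t| ≤ 1 := fun t => by
      rw [abs_of_nonneg (Real.smoothTransition.nonneg _)]
      exact Real.smoothTransition.le_one _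
    have hdχ1 : ∀ t, 2 < t → deriv χ t = 0 := fun t ht => by
      have : χ =ᶠ[nhds t] fun _ => 1 := by
        filter_upwards [Ioi_mem_nhds ht] with s hs using hχ1 s (le_of_lt hs)
      rw [this.deriv_eq, deriv_const]
    have hdχ0 : ∀ t < 1, deriv χ t = 0 := fun t ht => by
      have : χ =ᶠ[nhds t] fun _ => 0 := by
        filter_upwards [Iio_mem_nhds ht] with s hs using hχ0 s (le_of_lt hs)
      rw [this.deriv_eq, deriv_const]
    -- `t χ'(t)` is bounded, so the derivative of `χ(u / δ) u` is `O(|∇u|)` uniformly in `δ`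
    obtain ⟨c, hc⟩ := (isCompact_Icc (a := (1 : ℝ)) (b := 2)).exists_bound_of_continuousOn
      (f := fun t => t * deriv χ t)
      (continuous_id.mul (hχs.continuous_deriv le_rfl)).continuousOn
    have hc0 : 0 ≤ c := (norm_nonneg _).trans (hc 1 (by norm_num))
    have hcb : ∀ t, |t * deriv χ t| ≤ c := fun t => by
      by_cases ht : t ∈ Icc (1 : ℝ) 2
      · exact hc t ht
      · have : deriv χ t = 0 := by
          rcases lt_or_ge t 1 with h | h
          · exact hdχ0 t h
          · exact hdχ1 t (not_le.1 fun h' => ht ⟨h, h'⟩)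
        simpa [this] using hc0
    -- the truncations `χ(u / δ) u` with `δ = 1 / (m + 1)`
    set f : ℕ → Pt n → ℝ := fun m X => χ ((m + 1) * u X) * u X with hf
    have hu2 := hu.contDiffOn
    have hu1 : ContDiffOn ℝ 1 u W := hu2.of_le (by norm_num)
    have hVc : ∀ m, ContDiff ℝ 1 fun X => f m X • Q X := by
      intro m
      refine contDiff_of_contDiffOn_of_eventually_zero hW ?_ fun X hX => ?_
      · exact ((hχs.comp_contDiffOn (contDiffOn_const.mul hu1)).mul hu1).smul hQ
      · by_cases hXK : X ∈ K
        · have hXΩ := hKΩ hXK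
          have hca : ContinuousAt (fun X => (m + 1) * u X) X :=
            continuousAt_const.mul (hcont.continuousAt (hΩ.mem_nhds hXΩ))
          have hlt : ((m : ℝ) + 1) * u X < 1 := by
            rw [hzero X ⟨hXΩ, hX⟩, mul_zero]; exact one_pos
          filter_upwards [hca.eventually (Iio_mem_nhds hlt)] with Y hY
          simp only [hf]
          rw [hχ0 _ (le_of_lt hY), zero_mul, zero_smul]
        · filter_upwards [hK.isClosed.isOpen_compl.mem_nhds hXK] with Y hY
          rw [hQz Y hY, smul_zero]
    have hint : ∀ m, ∫ X in Ω, divergence (fun X => f m X • Q X) X = 0 := fun m =>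
      setIntegral_divergence_eq_zero (hVc m) hK hKΩ fun X hX => by rw [hQz X hX, smul_zero]
    have hdiv : ∀ m, ∀ X ∈ W, divergence (fun X => f m X • Q X) X =
        χ ((m + 1) * u X) * (inner ℝ (gradient u X) (Q X) + u X * divergence Q X) +
          ((m + 1) * u X * deriv χ ((m + 1) * u X)) * inner ℝ (gradient u X) (Q X) := by
      intro m X hX
      have hd1 : DifferentiableAt ℝ u X := ((hu X hX).1).differentiableAt two_ne_zero
      have hd2 : DifferentiableAt ℝ Q X :=
        (hQ.contDiffAt (hW.mem_nhds hX)).differentiableAt one_ne_zero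
      have hχd : HasDerivAt χ (deriv χ ((m + 1) * u X)) ((m + 1) * u X) :=
        (hχs.differentiable one_ne_zero).differentiableAt.hasDerivAt
      have hfd := (hχd.comp_hasFDerivAt X (hd1.hasFDerivAt.const_mul ((m : ℝ) + 1))).mul
        hd1.hasFDerivAt
      have hfd' : HasFDerivAt (f m) _ X := hfd
      rw [divergence_smul hfd'.differentiableAt hd2, hfd'.fderiv, inner_gradient_left]
      simp only [hf, add_apply, smul_apply, smul_eq_mul, Function.comp]
      ring
    have haeW : ∀ᵐ X ∂(volume.restrict Ω), X ∈ W := by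
      rw [ae_restrict_iff' hΩ.measurableSet, ae_iff]
      refine measure_mono_null (fun X hX => ?_) hnull
      simp only [mem_ofPred_eq, Classical.not_imp] at hX
      exact hX
    have hlim := tendsto_integral_of_dominated_convergence (μ := volume.restrict Ω)
      (F := fun m X => divergence (fun X => f m X • Q X) X)
      (f := fun X => inner ℝ (gradient u X) (Q X) + u X * divergence Q X)
      (fun X => |inner ℝ (gradient u X) (Q X) + u X * divergence Q X| +
        c * |inner ℝ (gradient u X) (Q X)|)
      (fun m => (continuous_divergence (hVc m)).aestronglyMeasurable)
      ((hi1.add hi2).abs.add (hi1.abs.const_mul c)) ?_ ?_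
    · simp only [hint] at hlim
      exact (tendsto_nhds_unique hlim tendsto_const_nhds)
    · intro m
      filter_upwards [haeW] with X hX
      rw [hdiv m X hX, Real.norm_eq_abs]
      refine (abs_add_le _ _).trans ?_
      rw [abs_mul, abs_mul]
      gcongr
      · exact mul_le_of_le_one_left (abs_nonneg _) (hχle _)
      · exact hcb _
    · filter_upwards [haeW] with X hX
      simp only [hdiv _ X hX]
      rcases (hnn X (hWΩ hX)).eq_or_lt with h0 | hpos
      · -- an interior zero is a minimum, so the gradient vanishes there
        have hg : fderiv ℝ u X = 0 := by
          refine IsLocalMin.fderiv_eq_zero ?_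
          filter_upwards [hW.mem_nhds hX] with Y hY
          rw [← h0]
          exact hnn Y (hWΩ hY)
        simp [inner_gradient_left, hg, ← h0]
      · refine tendsto_const_nhds.congr' ?_
        have htop : Filter.Tendsto (fun m : ℕ => ((m : ℝ) + 1) * u X) Filter.atTop Filter.atTop :=
          (Filter.tendsto_atTop_add_const_right _ _ tendsto_natCast_atTop_atTop).atTop_mul_const
            hpos
        filter_upwards [htop.eventually_gt_atTop 2] with m hm
        rw [hχ1 _ hm.le, hdχ1 _ hm]
        ring

namespace HarmonicWithParts

variable {X₀ : Pt n} {R : ℝ} {W : Set (Pt n)} {u : Pt n → ℝ}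

lemma ae_mem {Ω : Set (Pt n)} (hΩ : MeasurableSet Ω) (h : HarmonicWithParts Ω W u) :
    ∀ᵐ X ∂(volume.restrict Ω), X ∈ W := by
  rw [ae_restrict_iff' hΩ, ae_iff]
  refine measure_mono_null (fun X hX => ?_) h.null
  simp only [mem_ofPred_eq, Classical.not_imp] at hX
  exact hX

lemma integrable_radial_mul {F : Pt n → ℝ} {w : ℝ → ℝ} (hF : IntegrableOn F (ball X₀ R))
    (hw : Continuous w) : IntegrableOn (fun X => w ‖X - X₀‖ * F X) (ball X₀ R) :=
  (integral_ball_radial_mul hF hw).1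

lemma memLp_inner (h : HarmonicWithParts (ball X₀ R) W u) :
    MemLp (fun X => inner ℝ (gradient u X) (X - X₀)) 2 (volume.restrict (ball X₀ R)) := by
  refine h.memLp_grad.of_le_mul (c := R) ?_ ?_
  · exact h.memLp_grad.1.inner (by fun_prop : Continuous fun X => X - X₀).aestronglyMeasurable
  · refine (ae_restrict_iff' measurableSet_ball).2 (Filter.Eventually.of_forall fun X hX => ?_)
    rw [mem_ball, dist_eq_norm] at hX
    calc ‖inner ℝ (gradient u X) (X - X₀)‖ ≤ ‖gradient u X‖ * ‖X - X₀‖ := norm_inner_le_norm _ _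
      _ ≤ ‖gradient u X‖ * R := by gcongr
      _ = R * ‖gradient u X‖ := mul_comm _ _

lemma integrable_cross (h : HarmonicWithParts (ball X₀ R) W u) :
    IntegrableOn (fun X => u X * inner ℝ (gradient u X) (X - X₀)) (ball X₀ R) :=
  h.memLp_val.integrable_mul h.memLp_inner

/-- The field `u φ(|X - X₀|) (X - X₀)` in the parts formula. -/
lemma value_parts (h : HarmonicWithParts (ball X₀ R) W u) {φ : ℝ → ℝ} (hφ : RadialCutoff R φ) :
    ∫ X in ball X₀ R, (((n + 1) * φ ‖X - X₀‖ + ‖X - X₀‖ * deriv φ ‖X - X₀‖) * u X ^ 2 +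
      2 * φ ‖X - X₀‖ * (u X * inner ℝ (gradient u X) (X - X₀))) = 0 := by
  obtain ⟨K, hKR, hK, hz⟩ := hφ.exists_isCompact X₀
  have hdiv : ∀ X ∈ W, divergence (fun X => u X • radialField φ X₀ X) X =
      φ ‖X - X₀‖ * inner ℝ (gradient u X) (X - X₀) +
        u X * ((n + 1) * φ ‖X - X₀‖ + ‖X - X₀‖ * deriv φ ‖X - X₀‖) := fun X hX => by
    rw [divergence_smul ((h.harmonic X hX).1.differentiableAt two_ne_zero)
      ((hφ.contDiff_radialField X₀).differentiable (by simp) X), hφ.divergence_radialField,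
      radialField, map_smul, smul_eq_mul, inner_gradient_left]
  have hw : Continuous fun ρ => (n + 1) * φ ρ + ρ * deriv φ ρ :=
    (continuous_const.mul hφ.smooth.continuous).add (continuous_id.mul hφ.continuous_deriv)
  have i1 := integrable_radial_mul (X₀ := X₀) h.integrable_cross hφ.smooth.continuous
  have i2 := integrable_radial_mul (X₀ := X₀) h.memLp_val.integrable_sq hw
  have hae := h.ae_mem measurableSet_ball
  have key := h.parts (fun X => u X • radialField φ X₀ X) K
    ((h.harmonic.contDiffOn.of_le (by norm_num)).smul
      ((hφ.contDiff_radialField X₀).of_le (by exact_mod_cast le_top)).contDiffOn) hK hKR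
    (fun X hX => by rw [radialField, hz X hX, zero_smul, smul_zero]) ?_ ?_
  · rw [← key]
    refine integral_congr_ae ?_
    filter_upwards [hae] with X hX
    simp only [hdiv X hX]
    rw [inner_smul_right, radialField, inner_smul_right]
    ring
  · refine i1.congr (Filter.Eventually.of_forall fun X => ?_)
    simp only [radialField, inner_smul_right]
    ring
  · refine (i1.add i2).congr ?_
    filter_upwards [hae] with X hX
    simp only [Pi.add_apply, hdiv X hX]
    ring

/-- The field `φ(|X - X₀|) ∇u` in the parts formula. -/
lemma energy_parts (h : HarmonicWithParts (ball X₀ R) W u) {φ : ℝ → ℝ} (hφ : RadialCutoff R φ) :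
    ∫ X in ball X₀ R, (φ ‖X - X₀‖ * ‖gradient u X‖ ^ 2 +
      deriv φ ‖X - X₀‖ / ‖X - X₀‖ * (u X * inner ℝ (gradient u X) (X - X₀))) = 0 := by
  obtain ⟨K, hKR, hK, hz⟩ := hφ.exists_isCompact X₀
  have hdiv : ∀ X ∈ W, divergence (fun X => φ ‖X - X₀‖ • gradient u X) X =
      deriv φ ‖X - X₀‖ / ‖X - X₀‖ * inner ℝ (gradient u X) (X - X₀) := fun X hX => by
    rw [divergence_smul (hφ.hasFDerivAt X₀ X).differentiableAt
      ((contDiffAt_gradient (h.harmonic X hX).1).differentiableAt one_ne_zero),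
      divergence_gradient (h.harmonic X hX).1, (h.harmonic X hX).2.eq_of_nhds,
      (hφ.hasFDerivAt X₀ X).fderiv, real_inner_comm]
    simp
  have i1 := integrable_radial_mul (X₀ := X₀) h.memLp_grad.norm.integrable_sq
    hφ.smooth.continuous
  have i2 := integrable_radial_mul (X₀ := X₀) h.integrable_cross hφ.continuous_deriv_div
  have hae := h.ae_mem measurableSet_ball
  have key := h.parts (fun X => φ ‖X - X₀‖ • gradient u X) K
    (((hφ.contDiff X₀).of_le (by exact_mod_cast le_top)).contDiffOn.smul fun X hX =>
      (contDiffAt_gradient (h.harmonic X hX).1).contDiffWithinAt) hK hKR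
    (fun X hX => by rw [hz X hX, zero_smul]) ?_ ?_
  · rw [← key]
    refine integral_congr_ae ?_
    filter_upwards [hae] with X hX
    simp only [hdiv X hX]
    rw [inner_smul_right, real_inner_self_eq_norm_sq]
    ring
  · refine i1.congr (Filter.Eventually.of_forall fun X => ?_)
    simp only [inner_smul_right, real_inner_self_eq_norm_sq]
  · refine i2.congr ?_
    filter_upwards [hae] with X hX
    simp only [hdiv X hX]
    ring

end HarmonicWithParts

end Parts

/-! ### Almgren data of segregated profiles and of harmonic functions -/

section Construction

variable {n k : ℕ}

/-- The integrand of the domain variation formula for the field `φ(|X - X₀|) (X - X₀)`. -/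
lemma RadialCutoff.variation_eq {R : ℝ} {φ : ℝ → ℝ} (hφ : RadialCutoff R φ) (X₀ : Pt n)
    (g : Fin k → Pt n → Pt n) (X : Pt n) :
    ∑ i, inner ℝ (fderiv ℝ (radialField φ X₀) X (g i X)) (g i X) -
      1 / 2 * divergence (radialField φ X₀) X * fieldSq g X =
    ((1 - n) / 2 * φ ‖X - X₀‖ - ‖X - X₀‖ * deriv φ ‖X - X₀‖ / 2) * fieldSq g X +
      deriv φ ‖X - X₀‖ / ‖X - X₀‖ * radialSq X₀ g X := by
  have : ∑ i, inner ℝ (fderiv ℝ (radialField φ X₀) X (g i X)) (g i X) =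
      φ ‖X - X₀‖ * fieldSq g X + deriv φ ‖X - X₀‖ / ‖X - X₀‖ * radialSq X₀ g X := by
    simp only [fieldSq, radialSq, Finset.mul_sum, ← Finset.sum_add_distrib]
    refine Finset.sum_congr rfl fun i _ => ?_
    rw [hφ.fderiv_radialField, inner_add_left, real_inner_smul_left, real_inner_smul_left,
      real_inner_self_eq_norm_sq, real_inner_comm (g i X) (X - X₀)]
    ring
  rw [this, hφ.divergence_radialField]
  ring

/-- Almgren's three identities for a vector function whose components can be integrated by parts,
and which is stationary under radial domain variations. -/
lemma almgrenData_of_parts {X₀ : Pt n} {R : ℝ} {W : Fin k → Set (Pt n)} {u : Fin k → Pt n → ℝ}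
    {g : Fin k → Pt n → Pt n} (h : ∀ i, HarmonicWithParts (ball X₀ R) (W i) (u i))
    (hg : ∀ i, g i =ᵐ[volume.restrict (ball X₀ R)] gradient (u i))
    (hvar : ∀ φ, RadialCutoff R φ → ∫ X in ball X₀ R,
      (∑ i, inner ℝ (fderiv ℝ (radialField φ X₀) X (g i X)) (g i X) -
        1 / 2 * divergence (radialField φ X₀) X * fieldSq g X) = 0) :
    AlmgrenData X₀ R u g := by
  have hae : ∀ᵐ X ∂(volume.restrict (ball X₀ R)), ∀ i, g i X = gradient (u i) X :=
    ae_all_iff.2 hg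
  refine ⟨fun i => (h i).cont, fun i => (h i).memLp_val,
    fun i => (memLp_congr_ae (hg i)).2 (h i).memLp_grad, fun φ hφ => ?_, fun φ hφ => ?_,
    fun φ hφ => ?_⟩
  · have hw : Continuous fun ρ => (n + 1) * φ ρ + ρ * deriv φ ρ :=
      (continuous_const.mul hφ.smooth.continuous).add (continuous_id.mul hφ.continuous_deriv)
    have hw2 : Continuous fun ρ => 2 * φ ρ := continuous_const.mul hφ.smooth.continuous
    rw [← Finset.sum_eq_zero (s := Finset.univ) fun i _ => (h i).value_parts hφ,
      ← integral_finsetSum]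
    · refine integral_congr_ae ?_
      filter_upwards [hae] with X hX
      simp only [valueSq, crossRad, hX, Finset.mul_sum, ← Finset.sum_add_distrib]
    · exact fun i _ => (HarmonicWithParts.integrable_radial_mul (h i).memLp_val.integrable_sq
        hw).add (HarmonicWithParts.integrable_radial_mul (h i).integrable_cross hw2)
  · rw [← Finset.sum_eq_zero (s := Finset.univ) fun i _ => (h i).energy_parts hφ,
      ← integral_finsetSum]
    · refine integral_congr_ae ?_
      filter_upwards [hae] with X hX
      simp only [fieldSq, crossRad, hX, Finset.mul_sum, ← Finset.sum_add_distrib]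
    · exact fun i _ => (HarmonicWithParts.integrable_radial_mul
        (h i).memLp_grad.norm.integrable_sq hφ.smooth.continuous).add
        (HarmonicWithParts.integrable_radial_mul (h i).integrable_cross hφ.continuous_deriv_div)
  · simpa only [hφ.variation_eq] using hvar φ hφ

lemma integrable_of_continuousOn_of_forall_notMem {F : Type*} [NormedAddCommGroup F]
    {f : Pt n → F} {K : Set (Pt n)} (hK : IsCompact K) (hf : ContinuousOn f K)
    (hz : ∀ X ∉ K, f X = 0) : Integrable f := by
  rw [← integrableOn_iff_integrable_of_support_subset (s := K)]
  · exact hf.integrableOn_compact hK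
  · intro X hX
    by_contra h
    exact hX (hz X h)

/-- Where `f` is `C²`, every weak gradient is the classical one. -/
lemma IsWeakGradient.ae_eq_gradient {Ω W : Set (Pt n)} {f : Pt n → ℝ} {G : Pt n → Pt n}
    (hG : IsWeakGradient Ω f G) (hW : IsOpen W) (hWΩ : W ⊆ Ω)
    (hf : ContDiffOn ℝ 2 f W) : ∀ᵐ X, X ∈ W → G X = gradient f X := by
  have hcf : ContinuousOn f W := hf.continuousOn
  have hcg : ContinuousOn (gradient f) W := fun X hX =>
    (contDiffAt_gradient (hf.contDiffAt (hW.mem_nhds hX))).continuousAt.continuousWithinAt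
  have key := hW.ae_eq_zero_of_integral_contDiff_smul_eq_zero (μ := volume)
    (f := fun X => G X - gradient f X)
    ((hG.locInt_grad.mono_set hWΩ).sub (hcg.locallyIntegrableOn hW.measurableSet)) ?_
  · filter_upwards [key] with X hX hXW using sub_eq_zero.1 (hX hXW)
  intro φ hφ hc hs
  have hz : ∀ X ∉ tsupport φ, φ X = 0 := fun X hX => image_eq_zero_of_notMem_tsupport hX
  have hzg : ∀ X ∉ tsupport φ, gradient φ X = 0 := fun X hX => by
    have : φ =ᶠ[nhds X] fun _ => 0 := by
      filter_upwards [(isClosed_tsupport φ).isOpen_compl.mem_nhds hX] with Y hY using hz Y hY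
    simp [gradient, this.fderiv_eq]
  have hφg : Continuous (gradient φ) := continuous_iff_continuousAt.2 fun X =>
    (contDiffAt_gradient (contDiff_infty.1 hφ 2).contDiffAt).continuousAt
  have i1 : Integrable fun X => φ X • gradient f X :=
    integrable_of_continuousOn_of_forall_notMem hc
      (hφ.continuous.continuousOn.smul (hcg.mono hs)) fun X hX => by rw [hz X hX, zero_smul]
  have i2 : Integrable fun X => f X • gradient φ X :=
    integrable_of_continuousOn_of_forall_notMem hc
      ((hcf.mono hs).smul hφg.continuousOn) fun X hX => by rw [hzg X hX, smul_zero]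
  have i3 : Integrable fun X => φ X • G X := by
    rw [← integrableOn_iff_integrable_of_support_subset (s := tsupport φ)]
    · exact (hG.locInt_grad.integrableOn_compact_subset (hs.trans hWΩ) hc).continuousOn_smul
        hφ.continuous.continuousOn hc
    · intro X hX
      by_contra h
      exact hX (by simp [hz X h])
  -- the classical integration by parts, one coordinate at a time
  have hparts : ∫ X, φ X • gradient f X = - ∫ X, f X • gradient φ X := by
    rw [eq_neg_iff_add_eq_zero, ← integral_add i1 i2]
    have i12 := i1.add i2
    ext j
    have hcomm := (EuclideanSpace.proj (𝕜 := ℝ) j).integral_comp_comm i12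
    simp only [Pi.add_apply] at hcomm
    refine Eq.trans hcomm.symm ?_
    have hd : ∀ X ∈ W, DifferentiableAt ℝ f X := fun X hX =>
      (hf.contDiffAt (hW.mem_nhds hX)).differentiableAt two_ne_zero
    have hV : ContDiff ℝ 1 fun X => (φ X * f X) • EuclideanSpace.single j (1 : ℝ) := by
      refine contDiff_of_contDiffOn_of_eventually_zero hW
        (((hφ.of_le (by exact_mod_cast le_top)).contDiffOn.mul (hf.of_le (by norm_num))).smul
          contDiffOn_const) fun X hX => ?_
      filter_upwards [(isClosed_tsupport φ).isOpen_compl.mem_nhds fun h => hX (hs h)] with Y hY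
      rw [hz Y hY, zero_mul, zero_smul]
    have hdiv := setIntegral_divergence_eq_zero (Ω := W) hV hc hs fun X hX => by
      rw [hz X hX, zero_mul, zero_smul]
    rw [← setIntegral_eq_integral_of_forall_compl_eq_zero (s := W) fun X hX => by
      simp [hz X fun h => hX (hs h), hzg X fun h => hX (hs h)]]
    refine Eq.trans (setIntegral_congr_fun hW.measurableSet fun X hX => ?_) hdiv
    have hφd : DifferentiableAt ℝ φ X := (hφ.differentiable (by simp)).differentiableAt
    have hg : ∀ (v : Pt n → ℝ), gradient v X j = fderiv ℝ v X (EuclideanSpace.single j 1) :=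
      fun v => by rw [← inner_gradient_left, EuclideanSpace.inner_single_right]; simp
    simp only [PiLp.proj_apply, PiLp.add_apply, PiLp.smul_apply, smul_eq_mul, hg]
    rw [divergence_smul (hφd.fun_mul (hd X hX)) (differentiableAt_const _),
      fderiv_fun_mul hφd (hd X hX)]
    simp [divergence]
  have hweak := hG.parts φ ⟨hφ, hc, hs.trans hWΩ⟩
  rw [setIntegral_eq_integral_of_forall_compl_eq_zero fun X hX => by
      rw [hzg X fun h => hX (hWΩ (hs h)), smul_zero],
    setIntegral_eq_integral_of_forall_compl_eq_zero fun X hX => by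
      rw [hz X fun h => hX (hWΩ (hs h)), zero_smul]] at hweak
  simp only [smul_sub]
  rw [integral_sub i3 i1, hparts, hweak]
  simp

lemma MemH1.isWeakGradient {Ω : Set (Pt n)} {f : Pt n → ℝ} (h : MemH1 Ω f) :
    IsWeakGradient Ω f (weakGradient Ω f) := by
  obtain ⟨-, G, hG, -⟩ := h
  have hex : ∃ G, IsWeakGradient Ω f G := ⟨G, hG⟩
  rw [weakGradient, dif_pos hex]
  exact hex.choose_spec

lemma onPlane_last (x : EuclideanSpace ℝ (Fin n)) : onPlane x (Fin.last n) = 0 := by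
  simp [onPlane]

lemma mem_image_onPlane_nodalSet {Ω : Set (Pt n)} {f : Pt n → ℝ} {X : Pt n} :
    X ∈ onPlane '' nodalSet Ω f ↔ X ∈ Ω ∧ X (Fin.last n) = 0 ∧ f X = 0 := by
  constructor
  · rintro ⟨x, hx, rfl⟩
    exact ⟨hx.1, onPlane_last x, hx.2⟩
  · rintro ⟨h1, h2, h3⟩
    have hX : onPlane (WithLp.toLp 2 fun j : Fin n => X j.castSucc) = X := by
      ext j
      refine Fin.lastCases ?_ (fun i => ?_) j
      · rw [onPlane_last, h2]
      · simp [onPlane]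
    refine ⟨_, ⟨?_, ?_⟩, hX⟩
    · rwa [hX]
    · rwa [hX]

lemma volume_plane : volume {X : Pt n | X (Fin.last n) = 0} = 0 := by
  have := Measure.addHaar_submodule (volume : Measure (Pt n))
    (LinearMap.ker (EuclideanSpace.proj (𝕜 := ℝ) (Fin.last n)).toLinearMap) ?_
  · convert this using 2
    ext X
    simp [LinearMap.mem_ker]
  · intro h
    have h1 : (EuclideanSpace.single (Fin.last n) (1 : ℝ) : Pt n) ∈
        LinearMap.ker (EuclideanSpace.proj (𝕜 := ℝ) (Fin.last n)).toLinearMap := by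
      rw [h]; trivial
    simp at h1

lemma reflectZ_last (X : Pt n) : reflectZ X (Fin.last n) = - X (Fin.last n) := by
  simp [reflectZ]

lemma norm_reflectZ_sub {X₀ : Pt n} (h0 : X₀ (Fin.last n) = 0) (X : Pt n) :
    ‖reflectZ X - X₀‖ = ‖X - X₀‖ := by
  rw [EuclideanSpace.norm_eq, EuclideanSpace.norm_eq]
  congr 1
  refine Finset.sum_congr rfl fun j _ => ?_
  by_cases hj : j = Fin.last n
  · subst hj
    simp [reflectZ, h0]
  · simp [reflectZ, hj]

/-- The complement in `Ω` of the nodal set of `f`. -/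
def offNodal (Ω : Set (Pt n)) (f : Pt n → ℝ) : Set (Pt n) := Ω \ (onPlane '' nodalSet Ω f)

lemma ClassG.continuousOn {Ω : Set (Pt n)} {u : Fin k → Pt n → ℝ} (hu : ClassG Ω u)
    (hΩ : IsOpen Ω) (i : Fin k) : ContinuousOn (u i) Ω := by
  intro X hX
  obtain ⟨K, hK, hXK, hKΩ⟩ := exists_compact_subset hΩ hX
  obtain ⟨C, hC⟩ := hu.holder i K hKΩ hK
  exact ((hC.continuousOn (by norm_num)).continuousAt
    (mem_interior_iff_mem_nhds.1 hXK)).continuousWithinAt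

lemma ClassG.isOpen_offNodal {Ω : Set (Pt n)} {u : Fin k → Pt n → ℝ} (hu : ClassG Ω u)
    (hΩ : IsOpen Ω) (i : Fin k) : IsOpen (offNodal Ω (u i)) := by
  have : offNodal Ω (u i) =
      (Ω ∩ {X | X (Fin.last n) ≠ 0}) ∪ (Ω ∩ u i ⁻¹' {0}ᶜ) := by
    ext X
    simp only [offNodal, mem_sdiff, mem_image_onPlane_nodalSet, mem_union, mem_inter_iff,
      mem_ofPred_eq, mem_preimage, mem_compl_iff, mem_singleton_iff]
    tauto
  rw [this]
  refine IsOpen.union (hΩ.inter ?_)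
    ((hu.continuousOn hΩ i).isOpen_inter_preimage hΩ isOpen_compl_singleton)
  exact isOpen_ne_fun (by fun_prop) continuous_const

lemma ClassG.ae_weakGradient_eq {Ω : Set (Pt n)} {u : Fin k → Pt n → ℝ} (hu : ClassG Ω u)
    (hΩ : IsOpen Ω) (i : Fin k) {G : Pt n → Pt n} (hG : IsWeakGradient Ω (u i) G) :
    G =ᵐ[volume.restrict Ω] gradient (u i) := by
  have h1 := hG.ae_eq_gradient (hu.isOpen_offNodal hΩ i) sdiff_subset
    (hu.harmonic i).contDiffOn
  rw [Filter.EventuallyEq, ae_restrict_iff' hΩ.measurableSet]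
  filter_upwards [h1, compl_mem_ae_iff.2 (volume_plane (n := n))] with X hX hX' hXΩ
  exact hX ⟨hXΩ, fun h => hX' (mem_image_onPlane_nodalSet.1 h).2.1⟩

lemma ClassG.harmonicWithParts {Ω : Set (Pt n)} {u : Fin k → Pt n → ℝ} (hu : ClassG Ω u)
    (hΩ : IsOpen Ω) (i : Fin k) : HarmonicWithParts Ω (offNodal Ω (u i)) (u i) := by
  have hsub : Ω \ offNodal Ω (u i) ⊆ onPlane '' nodalSet Ω (u i) := by
    intro X hX
    by_contra h
    exact hX.2 ⟨hX.1, h⟩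
  obtain ⟨h1, G, hG, hG2⟩ := hu.memH1 i
  refine .of_nonneg hΩ (hu.isOpen_offNodal hΩ i) sdiff_subset
    (measure_mono_null (fun X hX => (mem_image_onPlane_nodalSet.1 (hsub hX)).2.1) volume_plane)
    (hu.harmonic i) (hu.continuousOn hΩ i) (hu.nonneg i)
    (fun X hX => (mem_image_onPlane_nodalSet.1 (hsub hX)).2.2) h1
    ((memLp_congr_ae (hu.ae_weakGradient_eq hΩ i hG)).1 hG2)

lemma ClassG.almgrenData {X₀ : Pt n} (h0 : X₀ (Fin.last n) = 0) {R : ℝ} {u : Fin k → Pt n → ℝ}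
    (hu : ClassG (ball X₀ R) u) :
    AlmgrenData X₀ R u fun i => weakGradient (ball X₀ R) (u i) := by
  refine almgrenData_of_parts (fun i => hu.harmonicWithParts isOpen_ball i)
    (fun i => hu.ae_weakGradient_eq isOpen_ball i (hu.memH1 i).isWeakGradient) fun φ hφ => ?_
  refine hu.variation _ (hφ.isTest_radialField X₀) fun X => ?_
  simp [radialField, norm_reflectZ_sub h0, reflectZ_last, h0]

lemma almgrenData_of_harmonicOnNhd {X₀ : Pt n} {R : ℝ} {w : Pt n → ℝ}
    (hw : InnerProductSpace.HarmonicOnNhd w (closedBall X₀ R)) :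
    AlmgrenData X₀ R (fun _ : Fin 1 => w) fun _ => gradient w := by
  have hwb : InnerProductSpace.HarmonicOnNhd w (ball X₀ R) := hw.mono ball_subset_closedBall
  have hcg : ContinuousOn (gradient w) (closedBall X₀ R) := fun X hX =>
    (contDiffAt_gradient (hw X hX).1).continuousAt.continuousWithinAt
  have hmem : ∀ {F : Type} [NormedAddCommGroup F] [SecondCountableTopology F]
      (f : Pt n → F), ContinuousOn f (closedBall X₀ R) →
      MemLp f 2 (volume.restrict (ball X₀ R)) := by
    intro F _ _ f hf
    obtain ⟨c, hc⟩ := (isCompact_closedBall X₀ R).exists_bound_of_continuousOn hf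
    have : IsFiniteMeasure (volume.restrict (ball X₀ R)) := ⟨by simp [measure_ball_lt_top]⟩
    refine MemLp.of_bound ((hf.mono ball_subset_closedBall).aestronglyMeasurable
      measurableSet_ball) c ?_
    exact (ae_restrict_iff' measurableSet_ball).2
      (Filter.Eventually.of_forall fun X hX => hc X (ball_subset_closedBall hX))
  have hparts := HarmonicWithParts.of_harmonicOnNhd isOpen_ball hwb
    (hmem w hw.contDiffOn.continuousOn) (hmem _ hcg)
  refine almgrenData_of_parts (W := fun _ => ball X₀ R) (fun _ => hparts)
    (fun _ => Filter.EventuallyEq.rfl) fun φ hφ => ?_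
  obtain ⟨K, hKR, hK, hz⟩ := hφ.exists_isCompact X₀
  set Y := radialField φ X₀ with hY
  have hY1 : ContDiff ℝ 1 Y := (hφ.contDiff_radialField X₀).of_le (by exact_mod_cast le_top)
  have hYz : ∀ X ∉ K, Y X = 0 := fun X hX => by rw [hY, radialField, hz X hX, zero_smul]
  have hg1 : ContDiffOn ℝ 1 (gradient w) (ball X₀ R) := fun X hX =>
    (contDiffAt_gradient (hwb X hX).1).contDiffWithinAt
  -- the stress-energy field, whose divergence is the integrand by harmonicity
  have hV : ContDiff ℝ 1 fun X => inner ℝ (gradient w X) (Y X) • gradient w X -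
      (1 / 2 * ‖gradient w X‖ ^ 2) • Y X := by
    refine contDiff_of_contDiffOn_of_eventually_zero isOpen_ball
      (((hg1.inner ℝ hY1.contDiffOn).smul hg1).sub
        ((contDiffOn_const.mul (hg1.norm_sq ℝ)).smul hY1.contDiffOn)) fun X hX => ?_
    filter_upwards [hK.isClosed.isOpen_compl.mem_nhds fun h => hX (hKR h)] with Z hZ
    simp [hYz Z hZ]
  rw [← setIntegral_divergence_eq_zero hV hK hKR fun X hX => by simp [hYz X hX]]
  refine setIntegral_congr_fun measurableSet_ball fun X hX => ?_
  have hw2 := (hwb X hX).1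
  have hgd : DifferentiableAt ℝ (gradient w) X :=
    (contDiffAt_gradient hw2).differentiableAt one_ne_zero
  have hYd : DifferentiableAt ℝ Y X := (hY1.differentiable one_ne_zero) X
  have hid : DifferentiableAt ℝ (fun X => inner ℝ (gradient w X) (Y X)) X := hgd.inner ℝ hYd
  have hnd : DifferentiableAt ℝ (fun X => 1 / 2 * ‖gradient w X‖ ^ 2) X :=
    (hgd.norm_sq ℝ).const_mul _
  have hnf : fderiv ℝ (fun X => 1 / 2 * ‖gradient w X‖ ^ 2) X (Y X) =
      inner ℝ (gradient w X) (fderiv ℝ (gradient w) X (Y X)) := by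
    rw [(hgd.hasFDerivAt.norm_sq.const_mul (1 / 2 : ℝ)).fderiv]
    simp
  have hsymm : inner ℝ (fderiv ℝ (gradient w) X (gradient w X)) (Y X) =
      inner ℝ (gradient w X) (fderiv ℝ (gradient w) X (Y X)) := by
    rw [inner_fderiv_gradient hw2, real_inner_comm, inner_fderiv_gradient hw2]
    exact (hw2.isSymmSndFDerivAt (by simp)) _ _
  simp only [fieldSq, Finset.univ_unique, Finset.sum_singleton]
  rw [divergence_sub (hid.fun_smul hgd) (hnd.fun_smul hYd), divergence_smul hid hgd,
    divergence_smul hnd hYd, divergence_gradient hw2, (hwb X hX).2.eq_of_nhds,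
    fderiv_inner_apply ℝ hgd hYd, hnf, hsymm, real_inner_comm (gradient w X)]
  simp
  ring

end Construction

/-! ### Unique continuation for harmonic functions -/

section UniqueContinuation

variable {n : ℕ}

/-- A harmonic function on a connected open set that vanishes near one point vanishes: the set of
points near which it vanishes is relatively closed, by the frequency bound on balls centred at
its points. -/
lemma eq_zero_of_harmonicOnNhd {U : Set (Pt n)} {w : Pt n → ℝ} (hU : IsOpen U)
    (hconn : IsPreconnected U) (hw : InnerProductSpace.HarmonicOnNhd w U) {p : Pt n} (hp : p ∈ U)
    (hzero : w =ᶠ[nhds p] 0) {X : Pt n} (hX : X ∈ U) : w X = 0 := by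
  set A : Set (Pt n) := {q | w =ᶠ[nhds q] 0} with hA
  have hAo : IsOpen A := isOpen_iff_mem_nhds.2 fun q hq => Filter.Eventually.eventually_nhds hq
  suffices U ⊆ A from (show w =ᶠ[nhds X] 0 from this hX).eq_of_nhds
  refine hconn.subset_of_closure_inter_subset hAo ⟨p, hp, hzero⟩ ?_
  rintro q ⟨hqA, hqU⟩
  obtain ⟨ε, hε, hεU⟩ := isOpen_iff.1 hU q hqU
  obtain ⟨c, hcA, hc⟩ := mem_closure_iff.1 hqA (ε / 3) (by positivity)
  have hsub : closedBall c (ε / 2) ⊆ U := fun Y hY => hεU <| by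
    rw [mem_closedBall] at hY
    rw [mem_ball]
    have := dist_triangle Y c q
    rw [dist_comm c q] at this
    linarith
  -- on the ball of radius `ε / 2` about `c`, which contains `q`, the height vanishes at small radii
  have hdata := almgrenData_of_harmonicOnNhd (hw.mono hsub)
  obtain ⟨s, hs, hsA⟩ := eventually_nhds_iff_ball.1 hcA
  have hr : min s (ε / 2) / 2 ∈ Ioo 0 (ε / 2) := by
    have h1 : 0 < min s (ε / 2) := lt_min hs (by positivity)
    have h2 := min_le_right s (ε / 2)
    exact ⟨by positivity, by linarith⟩
  have hr' : min s (ε / 2) / 2 ∈ Ioo 0 s := by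
    have h2 := min_le_left s (ε / 2)
    exact ⟨hr.1, by linarith [hr.1]⟩
  have hmean : sphereMean c (valueSq fun _ : Fin 1 => w) (min s (ε / 2) / 2) = 0 := by
    refine integral_eq_zero_of_ae (Filter.Eventually.of_forall fun ξ => ?_)
    have : w (c + (min s (ε / 2) / 2) • (ξ : Pt n)) = 0 :=
      hsA _ (add_smul_sphere_mem_ball hr' ξ)
    simp [valueSq, this]
  have hq : q ∈ ball c (ε / 2) := by
    rw [mem_ball]
    linarith
  filter_upwards [isOpen_ball.mem_nhds hq] with Y hY
  exact hdata.eq_zero_of_sphereMean_eq_zero hr hmean 0 hY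

lemma harmonicAt_comp_homothety {u : Pt n → ℝ} {X₀ Y : Pt n} {t : ℝ}
    (h : InnerProductSpace.HarmonicAt u (X₀ + t • Y)) :
    InnerProductSpace.HarmonicAt (fun Y => u (X₀ + t • Y)) Y := by
  have hcont : ContinuousAt (fun Y : Pt n => X₀ + t • Y) Y := by fun_prop
  refine ⟨ContDiffAt.comp (g := u) (f := fun Y : Pt n => X₀ + t • Y) Y h.1 (by fun_prop), ?_⟩
  have hlap : ∀ Z, Laplacian.laplacian (fun Y => u (X₀ + t • Y)) Z =
      t ^ 2 * Laplacian.laplacian u (X₀ + t • Z) := by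
    intro Z
    have hf : ∀ {F : Type} [NormedAddCommGroup F] [NormedSpace ℝ F] (v : Pt n → F),
        fderiv ℝ (fun Y => v (X₀ + t • Y)) = fun Y => t • fderiv ℝ v (X₀ + t • Y) := by
      intro F _ _ v
      funext Y
      have h1 := fderiv_comp_smul (𝕜 := ℝ) (f := fun Y => v (X₀ + Y)) (x := Y) t
      rw [h1, fderiv_comp_add_left]
    rw [InnerProductSpace.laplacian_eq_iteratedFDeriv_orthonormalBasis _
      (EuclideanSpace.basisFun (Fin (n + 1)) ℝ),
      InnerProductSpace.laplacian_eq_iteratedFDeriv_orthonormalBasis _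
      (EuclideanSpace.basisFun (Fin (n + 1)) ℝ)]
    simp only [iteratedFDeriv_two_apply, Finset.mul_sum]
    refine Finset.sum_congr rfl fun j _ => ?_
    have h2 : fderiv ℝ (fun Y => t • fderiv ℝ u (X₀ + t • Y)) Z =
        t • fderiv ℝ (fun Y => fderiv ℝ u (X₀ + t • Y)) Z :=
      congrFun (fderiv_const_smul_field (𝕜 := ℝ) (f := fun Y => fderiv ℝ u (X₀ + t • Y)) t) Z
    rw [hf u, h2, hf (fderiv ℝ u)]
    simp
    ring
  filter_upwards [hcont.eventually h.2] with Z hZ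
  rw [hlap, hZ]
  simp

end UniqueContinuation

/-! ### Homogeneity from constant frequency -/

section Homogeneity

variable {n k : ℕ} {X₀ : Pt n} {R : ℝ} {u : Fin k → Pt n → ℝ}

lemma add_last {X₀ : Pt n} (h0 : X₀ (Fin.last n) = 0) (Y : Pt n) :
    (X₀ + Y) (Fin.last n) = Y (Fin.last n) := by
  simp [h0]

lemma mem_offNodal (h0 : X₀ (Fin.last n) = 0) {f : Pt n → ℝ} {Y : Pt n} (hY : ‖Y‖ < R)
    (hz : Y (Fin.last n) ≠ 0) : X₀ + Y ∈ offNodal (ball X₀ R) f := by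
  refine ⟨by simpa [mem_ball, dist_eq_norm] using hY, fun h => hz ?_⟩
  rw [← add_last h0 Y]
  exact (mem_image_onPlane_nodalSet.1 h).2.1

/-- Homogeneity inside an annulus where Euler's identity `∇uᵢ · (X - X₀) = γ uᵢ` holds almost
everywhere, off the characteristic hyperplane. -/
lemma ClassG.homogeneous_annulus (hu : ClassG (ball X₀ R) u) (h0 : X₀ (Fin.last n) = 0)
    (i : Fin k) {γ a b : ℝ} (ha : 0 ≤ a) (hb : b ≤ R)
    (hae : ∀ᵐ X, X ∈ ball X₀ b \ closedBall X₀ a →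
      inner ℝ (gradient (u i) X) (X - X₀) = γ * u i X)
    {Y : Pt n} (hz : Y (Fin.last n) ≠ 0) (hY : ‖Y‖ ∈ Ioo a b) {t : ℝ} (ht : 0 < t)
    (htY : t * ‖Y‖ ∈ Ioo a b) : u i (X₀ + t • Y) = t ^ γ * u i (X₀ + Y) := by
  have hzmeas : IsOpen {X : Pt n | X (Fin.last n) ≠ 0} :=
    isOpen_ne_fun (by fun_prop) continuous_const
  have hO : IsOpen ((ball X₀ b \ closedBall X₀ a) ∩ {X : Pt n | X (Fin.last n) ≠ 0}) :=
    (isOpen_ball.sdiff isClosed_closedBall).inter hzmeas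
  set O := (ball X₀ b \ closedBall X₀ a) ∩ {X : Pt n | X (Fin.last n) ≠ 0} with hOdef
  have hOW : O ⊆ offNodal (ball X₀ R) (u i) := fun X hX =>
    ⟨ball_subset_ball hb hX.1.1, fun h => hX.2 (mem_image_onPlane_nodalSet.1 h).2.1⟩
  have hharm := (hu.harmonic i).mono hOW
  have heuler : EqOn (fun X => inner ℝ (gradient (u i) X) (X - X₀)) (fun X => γ * u i X) O := by
    refine Measure.eqOn_open_of_ae_eq (μ := volume) ?_ hO ?_ ?_
    · rw [Filter.EventuallyEq, ae_restrict_iff' hO.measurableSet]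
      filter_upwards [hae] with X hX hXO using hX hXO.1
    · refine ContinuousOn.inner (𝕜 := ℝ) (fun X hX => ?_) (by fun_prop)
      exact (contDiffAt_gradient (hharm X hX).1).continuousAt.continuousWithinAt
    · exact continuousOn_const.mul hharm.contDiffOn.continuousOn
  have hYpos : 0 < ‖Y‖ := ha.trans_lt hY.1
  have hmem : ∀ s ∈ Ioo (a / ‖Y‖) (b / ‖Y‖), 0 < s ∧ X₀ + s • Y ∈ O := by
    intro s hs
    have hs0 : 0 < s := (by positivity : 0 ≤ a / ‖Y‖).trans_lt hs.1
    have h1 := (div_lt_iff₀ hYpos).1 hs.1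
    have h2 := (lt_div_iff₀ hYpos).1 hs.2
    refine ⟨hs0, ⟨?_, ?_⟩, ?_⟩
    · rw [mem_ball, dist_eq_norm, add_sub_cancel_left, norm_smul, Real.norm_of_nonneg hs0.le]
      exact h2
    · rw [mem_closedBall, dist_eq_norm, add_sub_cancel_left, norm_smul,
        Real.norm_of_nonneg hs0.le]
      exact not_le.2 h1
    · rw [mem_ofPred_eq, add_last h0]
      simpa using ⟨hs0.ne', hz⟩
  -- `s ↦ s^(-γ) u(X₀ + sY)` is constant
  have hder : ∀ s ∈ Ioo (a / ‖Y‖) (b / ‖Y‖),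
      HasDerivAt (fun s => s ^ (-γ) * u i (X₀ + s • Y)) 0 s := by
    intro s hs
    obtain ⟨hs0, hsO⟩ := hmem s hs
    have h1 : HasDerivAt (fun s : ℝ => X₀ + s • Y) Y s := by
      simpa using ((hasDerivAt_id s).smul_const Y).const_add X₀
    have h2 := ((hharm _ hsO).1.differentiableAt two_ne_zero).hasFDerivAt.comp_hasDerivAt s h1
    have h3 := heuler hsO
    simp only [add_sub_cancel_left, inner_smul_right] at h3
    rw [inner_gradient_left] at h3
    refine ((Real.hasDerivAt_rpow_const (Or.inl hs0.ne')).mul h2).congr_deriv ?_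
    rw [Real.rpow_sub_one hs0.ne']
    simp only [Function.comp]
    field_simp
    rw [h3]
    ring
  have h1mem : (1 : ℝ) ∈ Ioo (a / ‖Y‖) (b / ‖Y‖) :=
    ⟨(div_lt_one hYpos).2 hY.1, (one_lt_div hYpos).2 hY.2⟩
  have htmem : t ∈ Ioo (a / ‖Y‖) (b / ‖Y‖) :=
    ⟨(div_lt_iff₀ hYpos).2 htY.1, (lt_div_iff₀ hYpos).2 htY.2⟩
  have hconst := isOpen_Ioo.is_const_of_deriv_eq_zero isPreconnected_Ioo
    (fun s hs => (hder s hs).differentiableAt.differentiableWithinAt)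
    (fun s hs => (hder s hs).deriv) htmem h1mem
  simp only [Real.one_rpow, one_mul, one_smul] at hconst
  rw [← hconst, ← mul_assoc, ← Real.rpow_add ht, add_neg_cancel, Real.rpow_zero, one_mul]

/-- The homogeneity relation with a ratio `t` close to `1` propagates from the annulus to the
upper half ball by unique continuation. -/
lemma ClassG.homogeneous_near_one (hu : ClassG (ball X₀ R) u) (h0 : X₀ (Fin.last n) = 0)
    (i : Fin k) {γ a b m : ℝ} (ha : 0 ≤ a) (hb : b ≤ R)
    (hae : ∀ᵐ X, X ∈ ball X₀ b \ closedBall X₀ a →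
      inner ℝ (gradient (u i) X) (X - X₀) = γ * u i X)
    (hm : m ∈ Ioo a b) {t : ℝ} (ht : 0 < t) (htm : t * m ∈ Ioo a b)
    {Y : Pt n} (hz : 0 < Y (Fin.last n)) (hY : ‖Y‖ < R) (htY : t * ‖Y‖ < R) :
    u i (X₀ + t • Y) = t ^ γ * u i (X₀ + Y) := by
  set U : Set (Pt n) := {Y | 0 < Y (Fin.last n)} ∩ (ball 0 R ∩ ball 0 (R / t)) with hUdef
  have hnorm : ∀ Y ∈ U, ‖Y‖ < R ∧ t * ‖Y‖ < R := fun Y hY => by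
    obtain ⟨-, h1, h2⟩ := hY
    rw [mem_ball_zero_iff] at h1 h2
    rw [lt_div_iff₀ ht] at h2
    exact ⟨h1, by linarith⟩
  have hcontz : Continuous fun Y : Pt n => Y (Fin.last n) := by fun_prop
  have hU : IsOpen U := (isOpen_lt continuous_const hcontz).inter (isOpen_ball.inter isOpen_ball)
  have hconv : Convex ℝ U := by
    refine Convex.inter ?_ ((convex_ball _ _).inter (convex_ball _ _))
    exact convex_halfSpace_gt (EuclideanSpace.proj (𝕜 := ℝ) (Fin.last n)).toLinearMap.isLinear 0
  have hharm : InnerProductSpace.HarmonicOnNhd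
      (fun Y => u i (X₀ + t • Y) - t ^ γ * u i (X₀ + Y)) U := by
    intro Y hY
    have hzY : Y (Fin.last n) ≠ 0 := (ne_of_lt hY.1).symm
    have h1 : InnerProductSpace.HarmonicAt (fun Y => u i (X₀ + t • Y)) Y := by
      refine harmonicAt_comp_homothety (hu.harmonic i _ (mem_offNodal h0 ?_ ?_))
      · rw [norm_smul, Real.norm_of_nonneg ht.le]
        exact (hnorm Y hY).2
      · simpa using ⟨ht.ne', hzY⟩
    have h2 : InnerProductSpace.HarmonicAt (fun Y => u i (X₀ + (1 : ℝ) • Y)) Y := by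
      refine harmonicAt_comp_homothety (hu.harmonic i _ (mem_offNodal h0 ?_ ?_))
      · rw [one_smul]; exact (hnorm Y hY).1
      · simpa using hzY
    simp only [one_smul] at h2
    exact h1.sub (h2.const_smul (c := t ^ γ))
  have hm0 : 0 < m := ha.trans_lt hm.1
  -- a point of the annulus on the axis through `X₀`, near which the difference vanishes
  set p : Pt n := EuclideanSpace.single (Fin.last n) m with hp
  have hpn : ‖p‖ = m := by simp [hp, abs_of_pos hm0]
  have hpz : p (Fin.last n) = m := by simp [hp]
  have hpU : p ∈ U := by
    refine ⟨by simpa [hpz] using hm0, ?_, ?_⟩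
    · rw [mem_ball_zero_iff, hpn]; linarith [hm.2]
    · rw [mem_ball_zero_iff, hpn, lt_div_iff₀ ht]; linarith [htm.2]
  have hnear : (fun Y => u i (X₀ + t • Y) - t ^ γ * u i (X₀ + Y)) =ᶠ[nhds p] 0 := by
    have e1 : ∀ᶠ Y in nhds p, ‖Y‖ ∈ Ioo a b :=
      continuous_norm.continuousAt.eventually (isOpen_Ioo.mem_nhds (by simpa [hpn] using hm))
    have e2 : ∀ᶠ Y in nhds p, t * ‖Y‖ ∈ Ioo a b :=
      (continuous_const.mul continuous_norm).continuousAt.eventually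
        (isOpen_Ioo.mem_nhds (by simpa [hpn] using htm))
    filter_upwards [e1, e2, hU.mem_nhds hpU] with Y h1 h2 h3
    have := hu.homogeneous_annulus h0 i ha hb hae (ne_of_lt h3.1).symm h1 ht h2
    simp [this]
  have hYU : Y ∈ U := by
    refine ⟨hz, ?_, ?_⟩
    · rwa [mem_ball_zero_iff]
    · rw [mem_ball_zero_iff, lt_div_iff₀ ht]; linarith
  have := eq_zero_of_harmonicOnNhd hU hconv.isPreconnected hharm hpU hnear hYU
  exact sub_eq_zero.1 this

/-- Iterating ratios close to `1` gives all ratios. -/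
lemma ClassG.homogeneous_upper (hu : ClassG (ball X₀ R) u) (h0 : X₀ (Fin.last n) = 0)
    (i : Fin k) {γ a b : ℝ} (ha : 0 ≤ a) (hab : a < b) (hb : b ≤ R)
    (hae : ∀ᵐ X, X ∈ ball X₀ b \ closedBall X₀ a →
      inner ℝ (gradient (u i) X) (X - X₀) = γ * u i X)
    {Y : Pt n} (hz : 0 < Y (Fin.last n)) {t : ℝ} (ht : 0 < t) (hY : ‖Y‖ < R)
    (htY : t * ‖Y‖ < R) : u i (X₀ + t • Y) = t ^ γ * u i (X₀ + Y) := by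
  have hm : (a + b) / 2 ∈ Ioo a b := ⟨by linarith, by linarith⟩
  -- a root of `t` of high order is close enough to `1`
  obtain ⟨N, hN⟩ : ∃ N : ℕ, t ^ (1 / ((N : ℝ) + 1)) * ((a + b) / 2) ∈ Ioo a b := by
    have h1 : Filter.Tendsto (fun N : ℕ => t ^ (1 / ((N : ℝ) + 1)) * ((a + b) / 2)) Filter.atTop
        (nhds (t ^ (0 : ℝ) * ((a + b) / 2))) :=
      (tendsto_const_nhds.rpow tendsto_one_div_add_atTop_nhds_zero_nat
        (Or.inl ht.ne')).mul_const _
    rw [Real.rpow_zero, one_mul] at h1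
    exact (h1.eventually (isOpen_Ioo.mem_nhds hm)).exists
  set s := t ^ (1 / ((N : ℝ) + 1)) with hs
  have hs0 : 0 < s := Real.rpow_pos_of_pos ht _
  have hst : s ^ (N + 1) = t := by
    rw [hs, ← Real.rpow_natCast, ← Real.rpow_mul ht.le]
    push_cast
    rw [one_div_mul_cancel (by positivity), Real.rpow_one]
  have hbound : ∀ j ≤ N + 1, s ^ j * ‖Y‖ < R := by
    intro j hj
    rcases le_total s 1 with h | h
    · exact (mul_le_of_le_one_left (norm_nonneg _) (pow_le_one₀ hs0.le h)).trans_lt hY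
    · refine lt_of_le_of_lt ?_ htY
      rw [← hst]
      gcongr
  have hind : ∀ j ≤ N + 1, u i (X₀ + s ^ j • Y) = (s ^ j) ^ γ * u i (X₀ + Y) := by
    intro j
    induction j with
    | zero => simp
    | succ j ih =>
      intro hj
      have h1 := hbound (j + 1) hj
      have h2 := hbound j (by omega)
      have hsj : 0 < s ^ j := pow_pos hs0 j
      have := hu.homogeneous_near_one h0 i ha hb hae hm hs0 hN (Y := s ^ j • Y)
        (by simpa using mul_pos hsj hz)
        (by rwa [norm_smul, Real.norm_of_nonneg hsj.le])
        (by rwa [norm_smul, Real.norm_of_nonneg hsj.le, ← mul_assoc, ← pow_succ'])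
      rw [smul_smul, ← pow_succ', ih (by omega), ← mul_assoc,
        ← Real.mul_rpow hs0.le hsj.le, ← pow_succ'] at this
      exact this
  have := hind (N + 1) le_rfl
  rwa [hst] at this

lemma reflectZ_add_smul (h0 : X₀ (Fin.last n) = 0) (t : ℝ) (Y : Pt n) :
    reflectZ (X₀ + t • Y) = X₀ + t • reflectZ Y := by
  ext j
  by_cases hj : j = Fin.last n
  · subst hj
    simp [reflectZ, h0]
  · simp [reflectZ, hj]

lemma norm_reflectZ (Y : Pt n) : ‖reflectZ Y‖ = ‖Y‖ := by
  simpa using norm_reflectZ_sub (X₀ := (0 : Pt n)) (by simp) Y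

/-- All points: the lower half ball by reflection, the hyperplane by continuity. -/
lemma ClassG.homogeneous (hu : ClassG (ball X₀ R) u) (h0 : X₀ (Fin.last n) = 0)
    (i : Fin k) {γ a b : ℝ} (ha : 0 ≤ a) (hab : a < b) (hb : b ≤ R)
    (hae : ∀ᵐ X, X ∈ ball X₀ b \ closedBall X₀ a →
      inner ℝ (gradient (u i) X) (X - X₀) = γ * u i X)
    {Y : Pt n} {t : ℝ} (ht : 0 < t) (hY : ‖Y‖ < R)
    (htY : t * ‖Y‖ < R) : u i (X₀ + t • Y) = t ^ γ * u i (X₀ + Y) := by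
  have hball : ∀ s : ℝ, 0 ≤ s → s * ‖Y‖ < R → X₀ + s • Y ∈ ball X₀ R := fun s hs h => by
    rwa [mem_ball, dist_eq_norm, add_sub_cancel_left, norm_smul, Real.norm_of_nonneg hs]
  rcases lt_trichotomy (Y (Fin.last n)) 0 with hz | hz | hz
  · have h1 := hu.homogeneous_upper h0 i ha hab hb hae (Y := reflectZ Y)
      (by rw [reflectZ_last]; linarith) ht (by rwa [norm_reflectZ]) (by rwa [norm_reflectZ])
    have h2 := reflectZ_add_smul h0 1 Y
    simp only [one_smul] at h2
    rw [← reflectZ_add_smul h0, ← h2, hu.even i _ (hball t ht.le htY),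
      hu.even i _ (by simpa using hball 1 zero_le_one (by simpa using hY))] at h1
    exact h1
  · -- a point of the hyperplane is approached from above
    set e : Pt n := EuclideanSpace.single (Fin.last n) 1 with he
    have hcY : Continuous fun ε : ℝ => Y + ε • e := by fun_prop
    have hYt : Filter.Tendsto (fun ε : ℝ => Y + ε • e) (nhdsWithin 0 (Ioi 0)) (nhds Y) := by
      have := hcY.tendsto 0
      simp only [zero_smul, add_zero] at this
      exact this.mono_left nhdsWithin_le_nhds
    have hcont : ∀ s : ℝ, 0 ≤ s → s * ‖Y‖ < R → Filter.Tendsto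
        (fun ε : ℝ => u i (X₀ + s • (Y + ε • e))) (nhdsWithin 0 (Ioi 0))
        (nhds (u i (X₀ + s • Y))) := fun s hs h => by
      have h1 : ContinuousAt (u i) (X₀ + s • Y) :=
        (hu.continuousOn isOpen_ball i).continuousAt (isOpen_ball.mem_nhds (hball s hs h))
      exact h1.tendsto.comp (tendsto_const_nhds.add (hYt.const_smul s))
    have hl := hcont t ht.le htY
    have hr := hcont 1 zero_le_one (by simpa using hY)
    simp only [one_smul] at hr
    refine tendsto_nhds_unique hl ((hr.const_mul (t ^ γ)).congr' ?_)
    have hn1 : ∀ᶠ ε in nhdsWithin (0 : ℝ) (Ioi 0), ‖Y + ε • e‖ < R :=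
      hYt.norm.eventually (Iio_mem_nhds hY)
    have hn2 : ∀ᶠ ε in nhdsWithin (0 : ℝ) (Ioi 0), t * ‖Y + ε • e‖ < R :=
      (hYt.norm.const_mul t).eventually (Iio_mem_nhds htY)
    filter_upwards [hn1, hn2, self_mem_nhdsWithin] with ε h1 h2 h3
    refine (hu.homogeneous_upper h0 i ha hab hb hae ?_ ht h1 h2).symm
    simpa [hz, he] using h3
  · exact hu.homogeneous_upper h0 i ha hab hb hae hz ht hY htY

end Homogeneity

/-! ### The frequency function of a segregated profile -/

section Frequency

variable {n k : ℕ} {X₀ : Pt n} {R : ℝ} {u : Fin k → Pt n → ℝ} {g : Fin k → Pt n → Pt n}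

lemma heightH_eq {r : ℝ} (hr : 0 < r) : heightH X₀ u r = sphereMean X₀ (valueSq u) r := by
  have : r ^ n ≠ 0 := by positivity
  rw [heightH, sphereIntegral, ← mul_assoc, one_div_mul_cancel this, one_mul]
  rfl

lemma frequencyN_eq {Ω : Set (Pt n)} {r : ℝ} (hr : 0 < r) :
    frequencyN Ω X₀ u r = AlmgrenData.freq X₀ u (fun i => weakGradient Ω (u i)) r := by
  have h1 : (∫ X in ball X₀ r, gradSq Ω u X) =
      AlmgrenData.dirichlet X₀ (fun i => weakGradient Ω (u i)) r := rfl
  have h2 : r ^ ((n : ℤ) - 1) = r ^ n / r := by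
    rw [zpow_sub_one₀ hr.ne', zpow_natCast, div_eq_mul_inv]
  rw [frequencyN, energyE, heightH_eq hr, AlmgrenData.freq, h1, h2, one_div_div]
  ring

namespace AlmgrenData

lemma sphereMean_valueSq_pos (h : AlmgrenData X₀ R u g) (h0 : ∃ i, ∃ X ∈ ball X₀ R, u i X ≠ 0)
    {r : ℝ} (hr : r ∈ Ioo 0 R) : 0 < sphereMean X₀ (valueSq u) r := by
  refine lt_of_le_of_ne (sphereMean_valueSq_nonneg r) fun hz => ?_
  obtain ⟨i, X, hX, hne⟩ := h0
  exact hne (h.eq_zero_of_sphereMean_eq_zero hr hz.symm i hX)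

lemma integrable_sphere_valueSq (h : AlmgrenData X₀ R u g) {r : ℝ} (hr : r ∈ Ioo 0 R) :
    Integrable (fun ξ : sphere (0 : Pt n) 1 => ∑ i, u i (X₀ + r • (ξ : Pt n)) ^ 2)
      (volume.toSphere) := by
  have hc : ContinuousOn (valueSq u) (ball X₀ R) :=
    continuousOn_finsetSum _ fun i _ => (h.cont i).pow 2
  have : Continuous fun ξ : sphere (0 : Pt n) 1 => valueSq u (X₀ + r • (ξ : Pt n)) :=
    hc.comp_continuous (by fun_prop) fun ξ => add_smul_sphere_mem_ball hr ξ
  exact this.integrable_of_hasCompactSupport (HasCompactSupport.of_compactSpace _)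

lemma monotoneOn_freq (h : AlmgrenData X₀ R u g)
    (hpos : ∀ r ∈ Ioo 0 R, 0 < sphereMean X₀ (valueSq u) r) :
    MonotoneOn (freq X₀ u g) (Ioo 0 R) := fun _ ha _ hb hab =>
  h.freq_le ha.1 hab hb.2 fun r hr => hpos r ⟨ha.1.trans_le hr.1, hr.2.trans_lt hb.2⟩

/-- The frequency stays bounded up to the outer radius, because the energy of the whole ball is
finite; monotonicity bounds it near the centre. -/
lemma exists_freq_le (h : AlmgrenData X₀ R u g) (hR : 0 < R)
    (hpos : ∀ r ∈ Ioo 0 R, 0 < sphereMean X₀ (valueSq u) r) :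
    ∃ M, ∀ r ∈ Ioo 0 R, freq X₀ u g r ≤ M := by
  have hmid : R / 2 ∈ Ioo 0 R := ⟨by linarith, by linarith⟩
  set M := dirichlet X₀ g R * (R / (R / 2) ^ n / sphereMean X₀ (valueSq u) (R / 2)) with hM
  have hbig : ∀ r ∈ Ico (R / 2) R, freq X₀ u g r ≤ M := by
    intro r hr
    have hr0 : r ∈ Ioo 0 R := ⟨by linarith [hr.1], hr.2⟩
    have hD : dirichlet X₀ g r ≤ dirichlet X₀ g R :=
      setIntegral_mono_set h.integrableOn_fieldSq
        (Filter.Eventually.of_forall fun _ => Finset.sum_nonneg fun _ _ => sq_nonneg _)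
        (ball_subset_ball hr.2.le).eventuallyLE
    have hH : sphereMean X₀ (valueSq u) (R / 2) ≤ sphereMean X₀ (valueSq u) r :=
      h.monotoneOn_sphereMean_valueSq hmid hr0 hr.1
    have h1 := hpos _ hmid
    have h2 := hr0.1
    rw [freq, hM]
    refine mul_le_mul hD ?_ (by have := hpos r hr0; positivity) (dirichlet_nonneg R)
    refine div_le_div₀ (by positivity) ?_ h1 hH
    exact div_le_div₀ hR.le hr.2.le (by positivity) (pow_le_pow_left₀ hmid.1.le hr.1 n)
  refine ⟨M, fun r hr => ?_⟩
  rcases le_total (R / 2) r with hle | hle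
  · exact hbig r ⟨hle, hr.2⟩
  · exact (h.monotoneOn_freq hpos hr hmid hle).trans (hbig _ ⟨le_rfl, hmid.2⟩)

lemma absContOn_freq (h : AlmgrenData X₀ R u g) (hR : 0 < R)
    (hpos : ∀ r ∈ Ioo 0 R, 0 < sphereMean X₀ (valueSq u) r) :
    AbsContOn (freq X₀ u g) (Ioo 0 R) := by
  obtain ⟨M, hM⟩ := h.exists_freq_le hR hpos
  refine absContOn_of_monotoneOn_of_bounded hR (h.monotoneOn_freq hpos)
    (fun r hr => freq_nonneg hr.1) hM fun a ha b hb hab => ?_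
  exact h.freq_sub_eq ha.1 hab hb.2 fun r hr =>
    hpos r ⟨ha.1.trans_le hr.1, hr.2.trans_lt hb.2⟩

/-- `(log H)' = 2 N / r`. -/
lemma hasDerivAt_log_sphereMean (h : AlmgrenData X₀ R u g)
    {r : ℝ} (hr : r ∈ Ioo 0 R) (hpos : 0 < sphereMean X₀ (valueSq u) r) :
    HasDerivAt (fun s => Real.log (sphereMean X₀ (valueSq u) s)) (2 * freq X₀ u g r / r) r := by
  refine ((h.hasDerivAt_sphereMean_valueSq hr).log hpos.ne').congr_deriv ?_
  have := hr.1
  rw [freq]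
  field_simp

/-- A homogeneous function has constant frequency, equal to its degree. -/
lemma freq_eq_of_homogeneous (h : AlmgrenData X₀ R u g) {γ : ℝ}
    (hhom : ∀ i, ∀ Y : Pt n, ∀ t : ℝ, 0 < t → ‖Y‖ < R → t * ‖Y‖ < R →
      u i (X₀ + t • Y) = t ^ γ * u i (X₀ + Y)) {r : ℝ} (hr : r ∈ Ioo 0 R)
    (hpos : 0 < sphereMean X₀ (valueSq u) r) : freq X₀ u g r = γ := by
  have hscale : ∀ s ∈ Ioo 0 R, sphereMean X₀ (valueSq u) s =
      ((s / r) ^ γ) ^ 2 * sphereMean X₀ (valueSq u) r := by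
    intro s hs
    rw [sphereMean, sphereMean, ← integral_const_mul]
    refine integral_congr_ae (Filter.Eventually.of_forall fun ξ => ?_)
    simp only [valueSq, Finset.mul_sum]
    refine Finset.sum_congr rfl fun i _ => ?_
    have hn := norm_smul_sphere hr.1.le ξ
    have h1 := hhom i (r • (ξ : Pt n)) (s / r) (div_pos hs.1 hr.1) (by rw [hn]; exact hr.2)
      (by rw [hn, div_mul_cancel₀ _ hr.1.ne']; exact hs.2)
    rw [smul_smul, div_mul_cancel₀ _ hr.1.ne'] at h1
    rw [h1, mul_pow]
  have hlog : (fun s => Real.log (sphereMean X₀ (valueSq u) s)) =ᶠ[nhds r]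
      fun s => 2 * (γ * (Real.log s - Real.log r)) + Real.log (sphereMean X₀ (valueSq u) r) := by
    filter_upwards [isOpen_Ioo.mem_nhds hr] with s hs
    have hsr : 0 < s / r := div_pos hs.1 hr.1
    rw [hscale s hs, Real.log_mul (by positivity) hpos.ne', Real.log_pow, Real.log_rpow hsr,
      Real.log_div hs.1.ne' hr.1.ne']
    push_cast
    ring
  have h1 := (h.hasDerivAt_log_sphereMean hr hpos).congr_of_eventuallyEq hlog.symm
  have h2 : HasDerivAt (fun s => 2 * (γ * (Real.log s - Real.log r)) +
      Real.log (sphereMean X₀ (valueSq u) r)) (2 * (γ * r⁻¹)) r :=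
    ((((Real.hasDerivAt_log hr.1.ne').sub_const _).const_mul γ).const_mul 2).add_const _
  have h3 := h1.unique h2
  have := hr.1
  field_simp at h3
  linarith

end AlmgrenData

lemma AbsContOn.congr {f f' : ℝ → ℝ} {s : Set ℝ} (hf : AbsContOn f s) (h : EqOn f' f s) :
    AbsContOn f' s := by
  intro ε hε
  obtain ⟨δ, hδ, H⟩ := hf ε hε
  refine ⟨δ, hδ, fun m a b hab hd hs => ?_⟩
  have : ∑ l, |f' (b l) - f' (a l)| = ∑ l, |f (b l) - f (a l)| :=
    Finset.sum_congr rfl fun l _ => by rw [h (hab l).1, h (hab l).2.1]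
  rw [this]
  exact H m a b hab hd hs

lemma ClassG.homogeneous_of_freq_eq (hu : ClassG (ball X₀ R) u) (h0 : X₀ (Fin.last n) = 0)
    (hpos : ∀ r ∈ Ioo 0 R, 0 < sphereMean X₀ (valueSq u) r) {γ a b : ℝ} (ha : 0 ≤ a)
    (hab : a < b) (hb : b ≤ R)
    (hγ : ∀ r ∈ Ioo a b,
      AlmgrenData.freq X₀ u (fun i => weakGradient (ball X₀ R) (u i)) r = γ)
    (i : Fin k) (Y : Pt n) (t : ℝ) (ht : 0 < t) (hY : ‖Y‖ < R) (htY : t * ‖Y‖ < R) :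
    u i (X₀ + t • Y) = t ^ γ * u i (X₀ + Y) := by
  have hd := hu.almgrenData h0
  have hwg : ∀ i, weakGradient (ball X₀ R) (u i)
      =ᵐ[volume.restrict (ball X₀ R)] gradient (u i) := fun i =>
    hu.ae_weakGradient_eq isOpen_ball i (hu.memH1 i).isWeakGradient
  refine hu.homogeneous h0 i ha hab hb ?_ ht hY htY
  have h1 := (ae_restrict_iff' measurableSet_ball).1 (hwg i)
  filter_upwards [hd.ae_inner_eq_of_freq_eq ha hb hpos hγ, h1] with X h2 h3 hX
  rw [← h3 (ball_subset_ball hb hX.1)]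
  exact h2 hX i

end Frequency

end Segregation

end

theorem mainTheorem9 (n k : ℕ) (hn : 1 ≤ n) (x₀ : EuclideanSpace ℝ (Fin n)) (r₀ : ℝ)
    (hr₀ : 0 < r₀) (u : Fin k → Segregation.Pt n → ℝ)
    (hu : Segregation.ClassG (ball (Segregation.onPlane x₀) r₀) u)
    (hu0 : ∃ i, ∃ X ∈ ball (Segregation.onPlane x₀) r₀, u i X ≠ 0) :
    let X₀ : Segregation.Pt n := Segregation.onPlane x₀
    let Ω : Set (Segregation.Pt n) := ball X₀ r₀
    let N : ℝ → ℝ := Segregation.frequencyN Ω X₀ u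
    -- well-definedness of `N`: the integrals in `E` and `H` converge, and `H` is positive
    (∀ r ∈ Ioo 0 r₀, IntegrableOn (Segregation.gradSq Ω u) (ball X₀ r) ∧
      Integrable (fun ξ : sphere (0 : Segregation.Pt n) 1 =>
        ∑ i, u i (X₀ + r • (ξ : Segregation.Pt n)) ^ 2) (volume.toSphere) ∧
      0 < Segregation.heightH X₀ u r) ∧
    Segregation.AbsContOn N (Ioo 0 r₀) ∧
    MonotoneOn N (Ioo 0 r₀) ∧
    (∀ r ∈ Ioo 0 r₀,
      HasDerivAt (fun s => Real.log (Segregation.heightH X₀ u s)) (2 * N r / r) r) ∧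
    (∀ γ a b : ℝ, 0 ≤ a → a < b → b ≤ r₀ → (∀ r ∈ Ioo a b, N r = γ) →
      (∀ r ∈ Ioo 0 r₀, N r = γ) ∧
      ∀ i, ∀ Y : Segregation.Pt n, ∀ t : ℝ, 0 < t → ‖Y‖ < r₀ → t * ‖Y‖ < r₀ →
        u i (X₀ + t • Y) = t ^ γ * u i (X₀ + Y)) := by
  intro X₀ Ω N
  have h0 : X₀ (Fin.last n) = 0 := Segregation.onPlane_last x₀
  have hd := hu.almgrenData h0
  have hpos := fun r (hr : r ∈ Ioo 0 r₀) => hd.sphereMean_valueSq_pos hu0 hr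
  have hN : ∀ r ∈ Ioo 0 r₀, N r = Segregation.AlmgrenData.freq X₀ u
      (fun i => Segregation.weakGradient Ω (u i)) r :=
    fun r hr => Segregation.frequencyN_eq hr.1
  refine ⟨fun r hr => ⟨?_, hd.integrable_sphere_valueSq hr, ?_⟩, ?_, ?_, fun r hr => ?_,
    fun γ a b ha hab hb hγ => ?_⟩
  · exact hd.integrableOn_fieldSq.mono_set (ball_subset_ball hr.2.le)
  · rw [Segregation.heightH_eq hr.1]
    exact hpos r hr
  · exact (hd.absContOn_freq hr₀ hpos).congr hN
  · exact (hd.monotoneOn_freq hpos).congr fun r hr => (hN r hr).symm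
  · rw [hN r hr]
    refine (hd.hasDerivAt_log_sphereMean hr (hpos r hr)).congr_of_eventuallyEq ?_
    filter_upwards [Ioi_mem_nhds hr.1] with s hs
    rw [Segregation.heightH_eq hs]
  · have hhom := hu.homogeneous_of_freq_eq h0 hpos ha hab hb (γ := γ) fun r hr => by
      rw [← hN r ⟨ha.trans_lt hr.1, hr.2.trans_le hb⟩]
      exact hγ r hr
    refine ⟨fun r hr => ?_, hhom⟩
    rw [hN r hr]
    exact hd.freq_eq_of_homogeneous hhom hr (hpos r hr)
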